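/- For positive integers $n,k$ put $\zeta_n(k)=\sum_{j=1}^n \frac1{j^k}$ and $L_n(k)=\sum_{j=1}^n\frac{(-1)^{j-1}}{j^k}$, let $\zeta$ be the Riemann zeta function, and define the double zeta-star values, for positive integers $q,p$ with $q\ge 2$, by $$\zeta^\star(q,\bar p)=\sum_{m=1}^\infty\frac1{m^q}\sum_{n=1}^m\frac{(-1)^n}{n^p},\quad \zeta^\star(\bar q,p)=\sum_{m=1}^\infty\frac{(-1)^m}{m^q}\sum_{n=1}^m\frac1{n^p},\quad \zeta^\star(\bar q,\bar p)=\sum_{m=1}^\infty\frac{(-1)^m}{m^q}\sum_{n=1}^m\frac{(-1)^n}{n^p}.$$ Then the series $\sum_{n\ge1} L_n(1)\zeta_n(2)/n^3$ and the series over $m$ defining $\zeta^\star(\bar5,\bar1)$, $\zeta^\star(4,\bar2)$, $\zeta^\star(\bar4,2)$, $\zeta^\star(\bar5,1)$ all converge absolutely, and $$\sum_{n=1}^\infty\frac{L_n(1)\,\zeta_n(2)}{n^3}=\frac{29}{8}\zeta(2)\zeta(3)\ln 2-\frac{93}{32}\zeta(5)\ln 2-\frac{1855}{128}\zeta(6)+\frac{17}{16}\zeta(3)^2-\zeta^\star(\bar5,\bar1)-\zeta^\star(4,\bar2)-4\,\zeta^\star(\bar4,2)-8\,\zeta^\star(\bar5,1).$$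 -/

import Mathlib

namespace EulerSum

/-- The generalized harmonic number `ζ_n(k) = ∑_{j=1}^n 1 / j^k`. -/
noncomputable def zetaPartial (n k : ℕ) : ℝ :=
  ∑ j ∈ Finset.Icc 1 n, 1 / (j : ℝ) ^ k

/-- The alternating harmonic number `L_n(k) = ∑_{j=1}^n (-1)^(j-1) / j^k`. -/
noncomputable def altPartial (n k : ℕ) : ℝ :=
  ∑ j ∈ Finset.Icc 1 n, (-1 : ℝ) ^ (j - 1) / (j : ℝ) ^ k

/-- An argument of a (possibly alternating) multiple zeta-star value: an exponent `s`,
with or without a bar on top of it. -/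
inductive Index where
  | plain (s : ℕ) : Index
  | bar (s : ℕ) : Index

/-- The factor attached to an index: `1 / n^s` for `s`, and `(-1)^n / n^s` for `s` with a bar. -/
noncomputable def Index.factor : Index → ℕ → ℝ
  | .plain s, n => 1 / (n : ℝ) ^ s
  | .bar s, n => (-1 : ℝ) ^ n / (n : ℝ) ^ s

/-- The `m`-th term of the double zeta-star series: the `a`-factor at `m` times the sum of the
`b`-factors over `1 ≤ n ≤ m`. -/
noncomputable def zetaStarTerm (a b : Index) (m : ℕ) : ℝ :=
  a.factor m * ∑ n ∈ Finset.Icc 1 m, b.factor n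

/-- The double zeta-star value, the sum over `m ≥ n ≥ 1` of the `a`-factor at `m` times the
`b`-factor at `n`. The outer index is `m + 1` with `m : ℕ`. -/
noncomputable def zetaStar (a b : Index) : ℝ :=
  ∑' m : ℕ, zetaStarTerm a b (m + 1)

end EulerSum

namespace EulerSum

open Finset Filter Topology

/-! Everything is expressed through strict nested sums with signs `x, y, w = ±1`: `doubleSum` for
one inner partial sum, `quadSum` for a product of two. Expanding the non-strict sums, the target is
minus the weight-6 sum `quadSum 1 3 (-1) 1 1 2` up to double sums and zeta values, and the star
values are double sums plus a diagonal zeta value.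

The quadratic sum is removed by a parity argument. A product of two tails, ∑_k y^k/(k+n)^a times ∑_j
w^j/(j+n)^b, is expanded in partial fractions in n. The coefficient at the pole n = -m involves
∑_{j≠m} w^j/(j-m)^b, which reflection about m turns into a limit plus or minus a partial sum.
Multiplying by x^n/n^q and summing over n, after subtracting the value at n = 0, gives a series in m
whose kernel is again computed by partial fractions. Both sides then consist of quadratic sums with
outer sign xyw and of simpler sums. This is `hasSum_sub_shiftKernel`, specialised in
`hasSum_shiftedSum_one_one` and `hasSum_shiftedSum_two_one`. Three instances (`parity_neg_pos_neg`,
`parity_pos_neg_neg`, `parity_linear_pos_neg_neg`) involve only four quadratic sums, and one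
combination of them leaves the target alone.

What remains is linear algebra over double sums. The relations are stuffle products, shuffle
products (from 1/(nm) = (1/n + 1/m)/(n+m) in Tornheim series), and the comparison of two evaluations
of T(1,r,1), which stands in for the double shuffle relation with the possibly divergent ∑ x^n/n.
They reduce everything to the four double sums behind the star values, log 2 and zeta values. -/

/-- The term `x ^ n / n ^ s` at `n = i + 1`. -/
noncomputable def signedTerm (x : ℝ) (s i : ℕ) : ℝ := x ^ (i + 1) / ((i : ℝ) + 1) ^ s

/-- The partial sum of `signedTerm x s` over `1 ≤ n ≤ N`. -/
noncomputable def signedSum (x : ℝ) (s N : ℕ) : ℝ := ∑ i ∈ range N, signedTerm x s i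

/-- The (alternating) zeta value `∑ x ^ n / n ^ s`. -/
noncomputable def signedZeta (x : ℝ) (s : ℕ) : ℝ := ∑' i, signedTerm x s i

/-- The double sum over `m > n ≥ 1` of `x ^ m / m ^ a * (y ^ n / n ^ b)`. -/
noncomputable def doubleSum (x : ℝ) (a : ℕ) (y : ℝ) (b : ℕ) : ℝ :=
  ∑' i, signedTerm x a i * signedSum y b i

/-- The quadratic sum of `x ^ m / m ^ a` times two strict partial sums. -/
noncomputable def quadSum (x : ℝ) (a : ℕ) (y : ℝ) (b : ℕ) (w : ℝ) (c : ℕ) : ℝ :=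
  ∑' i, signedTerm x a i * signedSum y b i * signedSum w c i

/-- The term of the (signed) Tornheim series. -/
noncomputable def tornheimTerm (x y : ℝ) (p r s : ℕ) (ij : ℕ × ℕ) : ℝ :=
  x ^ (ij.1 + 1) * y ^ (ij.2 + 1) /
    (((ij.1 : ℝ) + 1) ^ p * ((ij.2 : ℝ) + 1) ^ r * ((ij.1 : ℝ) + ij.2 + 2) ^ s)

/-- The signed Tornheim series `∑ x ^ n y ^ m / (n ^ p m ^ r (n + m) ^ s)`. -/
noncomputable def tornheim (x y : ℝ) (p r s : ℕ) : ℝ := ∑' ij, tornheimTerm x y p r s ij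

/-! ### Convergence of signed sums -/

theorem abs_eq_one_of_mul_self {x : ℝ} (hx : x * x = 1) : |x| = 1 := by
  rcases mul_self_eq_one_iff.mp hx with h | h <;> simp [h]

theorem abs_pow_of_mul_self {x : ℝ} (hx : x * x = 1) (n : ℕ) : |x ^ n| = 1 := by
  rw [abs_pow, abs_eq_one_of_mul_self hx, one_pow]

theorem pow_mul_pow_self {x : ℝ} (hx : x * x = 1) (n : ℕ) : x ^ n * x ^ n = 1 := by
  rw [← mul_pow, hx, one_pow]

theorem mul_mul_self_eq_one {x y : ℝ} (hx : x * x = 1) (hy : y * y = 1) :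
    x * y * (x * y) = 1 := by
  linear_combination y * y * hx + hy

theorem abs_signedTerm {x : ℝ} (hx : x * x = 1) (s i : ℕ) :
    |signedTerm x s i| = 1 / ((i : ℝ) + 1) ^ s := by
  rw [signedTerm, abs_div, abs_pow_of_mul_self hx, abs_of_pos (by positivity)]

theorem summable_one_div_succ_pow {s : ℕ} (hs : 2 ≤ s) :
    Summable (fun i : ℕ => 1 / ((i : ℝ) + 1) ^ s) := by
  have := (summable_nat_add_iff 1).mpr (Real.summable_one_div_nat_pow.mpr (show 1 < s by omega))
  simpa using this

theorem summable_signedTerm {x : ℝ} (hx : x * x = 1) {s : ℕ} (hs : 2 ≤ s) :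
    Summable (signedTerm x s) := by
  refine Summable.of_norm ?_
  simpa only [Real.norm_eq_abs, abs_signedTerm hx] using summable_one_div_succ_pow hs

theorem hasSum_signedTerm {x : ℝ} (hx : x * x = 1) {s : ℕ} (hs : 2 ≤ s) :
    HasSum (signedTerm x s) (signedZeta x s) := (summable_signedTerm hx hs).hasSum

theorem tendsto_signedSum {x : ℝ} (hx : x * x = 1) {s : ℕ} (hs : 2 ≤ s) :
    Tendsto (signedSum x s) atTop (𝓝 (signedZeta x s)) :=
  (hasSum_signedTerm hx hs).tendsto_sum_nat

theorem signedSum_zero (x : ℝ) (s : ℕ) : signedSum x s 0 = 0 := by simp [signedSum]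

theorem signedSum_succ (x : ℝ) (s n : ℕ) :
    signedSum x s (n + 1) = signedSum x s n + signedTerm x s n := by
  simp [signedSum, sum_range_succ]

/-- A crude bound that covers the divergent harmonic case `s = 1`. One square root still leaves
n^(-3/2) in double sums with outer exponent 2, and two leave n^(-2) in quadratic sums with outer
exponent 3. -/
theorem abs_signedSum_le_sqrt {x : ℝ} (hx : x * x = 1) {s : ℕ} (hs : 1 ≤ s) (n : ℕ) :
    |signedSum x s n| ≤ 2 * √n := by
  induction n with
  | zero => simp [signedSum_zero]
  | succ n ih =>
    rw [signedSum_succ]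
    refine (abs_add_le _ _).trans ?_
    rw [abs_signedTerm hx]
    have h1 : 1 / ((n : ℝ) + 1) ^ s ≤ 1 / ((n : ℝ) + 1) := by
      apply one_div_le_one_div_of_le (by positivity)
      exact le_self_pow₀ (by linarith [(Nat.cast_nonneg n : (0 : ℝ) ≤ n)]) (by omega)
    -- The right side telescopes, which closes the induction.
    have h2 : 1 / ((n : ℝ) + 1) ≤ 2 * (√(n + 1) - √n) := by
      have ha := Real.sq_sqrt (show (0 : ℝ) ≤ n by positivity)
      have hb := Real.sq_sqrt (show (0 : ℝ) ≤ n + 1 by positivity)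
      have hb1 : 1 ≤ √((n : ℝ) + 1) := by
        rw [Real.one_le_sqrt]; linarith [(Nat.cast_nonneg n : (0 : ℝ) ≤ n)]
      have hab : √(n : ℝ) ≤ √((n : ℝ) + 1) := Real.sqrt_le_sqrt (by linarith)
      have ha0 := Real.sqrt_nonneg (n : ℝ)
      set a := √(n : ℝ)
      set b := √((n : ℝ) + 1)
      rw [← hb, div_le_iff₀ (by positivity)]
      have : (b - a) * (b + a) = 1 := by nlinarith
      have h0 : 0 ≤ b - a := by linarith
      nlinarith [mul_nonneg h0 (mul_nonneg (by linarith : (0:ℝ) ≤ b) (by linarith : (0:ℝ) ≤ b - 1)),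
        mul_nonneg h0 (by linarith : (0:ℝ) ≤ b - a)]
    push_cast
    linarith

theorem summable_one_div_sqrt_cube :
    Summable (fun i : ℕ => 1 / (√((i : ℝ) + 1)) ^ 3) := by
  have := (summable_nat_add_iff 1).mpr
    (Real.summable_one_div_nat_rpow.mpr (show (1 : ℝ) < 3 / 2 by norm_num))
  refine this.congr fun i => ?_
  rw [Real.sqrt_eq_rpow, ← Real.rpow_natCast, ← Real.rpow_mul (by positivity)]
  norm_num

theorem summable_doubleSum {x y : ℝ} (hx : x * x = 1) (hy : y * y = 1) {a b : ℕ}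
    (ha : 2 ≤ a) (hb : 1 ≤ b) : Summable (fun i => signedTerm x a i * signedSum y b i) := by
  refine Summable.of_norm_bounded (summable_one_div_sqrt_cube.mul_left 2) fun i => ?_
  rw [Real.norm_eq_abs, abs_mul, abs_signedTerm hx]
  have h := abs_signedSum_le_sqrt hy hb i
  have hs : √(i : ℝ) ≤ √((i : ℝ) + 1) := Real.sqrt_le_sqrt (by linarith)
  have hq := Real.sq_sqrt (show (0 : ℝ) ≤ i + 1 by positivity)
  have hpos : 0 < √((i : ℝ) + 1) := by positivity
  have h1 : 1 / ((i : ℝ) + 1) ^ a ≤ 1 / ((i : ℝ) + 1) ^ 2 := by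
    apply one_div_le_one_div_of_le (by positivity)
    exact pow_le_pow_right₀ (by linarith [(Nat.cast_nonneg i : (0 : ℝ) ≤ i)]) ha
  calc _ ≤ 1 / ((i : ℝ) + 1) ^ 2 * (2 * √((i : ℝ) + 1)) := by gcongr; linarith
    _ = _ := by
      nth_rw 1 [← hq]; field_simp

theorem hasSum_doubleSum {x y : ℝ} (hx : x * x = 1) (hy : y * y = 1) {a b : ℕ}
    (ha : 2 ≤ a) (hb : 1 ≤ b) :
    HasSum (fun i => signedTerm x a i * signedSum y b i) (doubleSum x a y b) :=
  (summable_doubleSum hx hy ha hb).hasSum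

theorem hasSum_quadSum {x y w : ℝ} (hx : x * x = 1) (hy : y * y = 1) (hw : w * w = 1)
    {a b c : ℕ} (ha : 3 ≤ a) (hb : 1 ≤ b) (hc : 1 ≤ c) :
    HasSum (fun i => signedTerm x a i * signedSum y b i * signedSum w c i)
      (quadSum x a y b w c) := by
  refine Summable.hasSum (Summable.of_norm_bounded
    ((summable_one_div_succ_pow le_rfl).mul_left 4) fun i => ?_)
  rw [Real.norm_eq_abs, abs_mul, abs_mul, abs_signedTerm hx]
  have h := abs_signedSum_le_sqrt hy hb i
  have h' := abs_signedSum_le_sqrt hw hc i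
  have hq := Real.sq_sqrt (show (0 : ℝ) ≤ i by positivity)
  have hi : (0 : ℝ) ≤ i := by positivity
  have h1 : 1 / ((i : ℝ) + 1) ^ a ≤ 1 / ((i : ℝ) + 1) ^ 3 := by
    apply one_div_le_one_div_of_le (by positivity)
    exact pow_le_pow_right₀ (by linarith) ha
  calc _ ≤ 1 / ((i : ℝ) + 1) ^ 3 * (2 * √i) * (2 * √i) := by gcongr
    _ = 1 / ((i : ℝ) + 1) ^ 3 * (4 * i) := by linear_combination (1 / ((i : ℝ) + 1) ^ 3) * 4 * hq
    _ ≤ 1 / ((i : ℝ) + 1) ^ 3 * (4 * (i + 1)) := by gcongr; linarith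
    _ = _ := by field_simp

/-! ### Stuffle products and Tornheim series -/

/-- Stuffle product of two absolutely convergent zeta values. -/
theorem doubleSum_add_doubleSum {x y : ℝ} (hx : x * x = 1) (hy : y * y = 1) {a b : ℕ}
    (ha : 2 ≤ a) (hb : 2 ≤ b) :
    doubleSum x a y b + doubleSum y b x a + signedZeta (x * y) (a + b)
      = signedZeta x a * signedZeta y b := by
  have h := ((hasSum_doubleSum hx hy ha (by omega : 1 ≤ b)).add
    (hasSum_doubleSum hy hx hb (by omega : 1 ≤ a))).add
    (hasSum_signedTerm (mul_mul_self_eq_one hx hy) (by omega : 2 ≤ a + b))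
  refine tendsto_nhds_unique h.tendsto_sum_nat ?_
  refine ((tendsto_signedSum hx ha).mul (tendsto_signedSum hy hb)).congr fun N => ?_
  induction N with
  | zero => simp [signedSum_zero]
  | succ N ih =>
    rw [sum_range_succ, ← ih, signedSum_succ, signedSum_succ]
    simp only [signedTerm, mul_pow, pow_add, pow_one]
    field_simp
    ring

theorem summable_tornheimTerm {x y : ℝ} (hx : x * x = 1) (hy : y * y = 1) {p r s : ℕ}
    (h : (2 ≤ p ∧ 2 ≤ r) ∨ (1 ≤ p ∧ 1 ≤ r ∧ 1 ≤ s) ∨ (2 ≤ s ∧ (1 ≤ p ∨ 1 ≤ r))) :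
    Summable (tornheimTerm x y p r s) := by
  -- The majorant is (nm)^(-3/2). With a = √n and b = √m, every admissible exponent pattern follows
  -- from ab ≤ a² + b² = n + m together with a, b ≥ 1.
  refine Summable.of_norm_bounded (summable_one_div_sqrt_cube.mul_of_nonneg
    summable_one_div_sqrt_cube (fun i => by positivity) (fun i => by positivity)) fun ij => ?_
  obtain ⟨i, j⟩ := ij
  simp only [tornheimTerm]
  rw [Real.norm_eq_abs, abs_div, abs_mul, abs_pow_of_mul_self hx, abs_pow_of_mul_self hy,
    abs_of_pos (by positivity), one_mul, one_div_mul_one_div]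
  apply one_div_le_one_div_of_le (by positivity)
  have ha2 := Real.sq_sqrt (show (0 : ℝ) ≤ i + 1 by positivity)
  have hb2 := Real.sq_sqrt (show (0 : ℝ) ≤ j + 1 by positivity)
  have ha : 1 ≤ √((i : ℝ) + 1) := by
    rw [Real.one_le_sqrt]; linarith [(Nat.cast_nonneg i : (0 : ℝ) ≤ i)]
  have hb : 1 ≤ √((j : ℝ) + 1) := by
    rw [Real.one_le_sqrt]; linarith [(Nat.cast_nonneg j : (0 : ℝ) ≤ j)]
  have hsum : (i : ℝ) + j + 2 = √((i : ℝ) + 1) ^ 2 + √((j : ℝ) + 1) ^ 2 := by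
    rw [ha2, hb2]; ring
  rw [hsum, ← ha2, ← hb2]
  simp only [Real.sqrt_sq (by linarith : 0 ≤ √((i : ℝ) + 1)),
    Real.sqrt_sq (by linarith : 0 ≤ √((j : ℝ) + 1))]
  generalize √((i : ℝ) + 1) = a at *
  generalize √((j : ℝ) + 1) = b at *
  have ha0 : 0 ≤ a := by linarith
  have hb0 : 0 ≤ b := by linarith
  have hab : a * b ≤ a ^ 2 + b ^ 2 := by nlinarith [sq_nonneg (a - b), mul_nonneg ha0 hb0]
  have hab1 : 1 ≤ a ^ 2 + b ^ 2 := by nlinarith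
  have mono : ∀ {p' r' s' : ℕ}, p' ≤ p → r' ≤ r → s' ≤ s →
      (a ^ 2) ^ p' * (b ^ 2) ^ r' * (a ^ 2 + b ^ 2) ^ s'
        ≤ (a ^ 2) ^ p * (b ^ 2) ^ r * (a ^ 2 + b ^ 2) ^ s := by
    intro p' r' s' h1 h2 h3
    have e1 := pow_le_pow_right₀ (one_le_pow₀ ha : 1 ≤ a ^ 2) h1
    have e2 := pow_le_pow_right₀ (one_le_pow₀ hb : 1 ≤ b ^ 2) h2
    have e3 := pow_le_pow_right₀ hab1 h3
    gcongr
  have hA : a ^ 3 ≤ a ^ 4 := pow_le_pow_right₀ ha (by norm_num)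
  have hB : b ^ 3 ≤ b ^ 4 := pow_le_pow_right₀ hb (by norm_num)
  rcases h with ⟨h1, h2⟩ | ⟨h1, h2, h3⟩ | ⟨h3, h1 | h1⟩
  · refine le_trans ?_ (mono h1 h2 (Nat.zero_le s))
    calc a ^ 3 * b ^ 3 ≤ a ^ 4 * b ^ 4 := by gcongr
      _ = _ := by ring
  · refine le_trans ?_ (mono h1 h2 h3)
    calc a ^ 3 * b ^ 3 = a ^ 2 * b ^ 2 * (a * b) := by ring
      _ ≤ a ^ 2 * b ^ 2 * (a ^ 2 + b ^ 2) := by gcongr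
      _ = _ := by ring
  · refine le_trans ?_ (mono h1 (Nat.zero_le r) h3)
    calc a ^ 3 * b ^ 3 = a ^ 2 * (a * b) * b ^ 2 := by ring
      _ ≤ a ^ 2 * (a ^ 2 + b ^ 2) * (a ^ 2 + b ^ 2) := by gcongr; nlinarith
      _ = _ := by ring
  · refine le_trans ?_ (mono (Nat.zero_le p) h1 h3)
    calc a ^ 3 * b ^ 3 = b ^ 2 * (a * b) * a ^ 2 := by ring
      _ ≤ b ^ 2 * (a ^ 2 + b ^ 2) * (a ^ 2 + b ^ 2) := by gcongr; nlinarith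
      _ = _ := by ring

/-- The recurrence `1 / (n m) = (1 / n + 1 / m) / (n + m)` summed over all `n, m`. -/
theorem tornheim_succ_succ {x y : ℝ} (hx : x * x = 1) (hy : y * y = 1) {p r s : ℕ}
    (h : 1 ≤ s ∨ (1 ≤ p ∧ 1 ≤ r)) :
    tornheim x y (p + 1) (r + 1) s
      = tornheim x y p (r + 1) (s + 1) + tornheim x y (p + 1) r (s + 1) := by
  unfold tornheim
  rw [← Summable.tsum_add (summable_tornheimTerm hx hy (by omega))
    (summable_tornheimTerm hx hy (by omega))]
  refine tsum_congr fun ij => ?_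
  simp only [tornheimTerm]
  field_simp
  ring

theorem tornheim_swap (x y : ℝ) (p r s : ℕ) : tornheim x y p r s = tornheim y x r p s := by
  unfold tornheim
  rw [← (Equiv.prodComm ℕ ℕ).tsum_eq]
  refine tsum_congr fun ij => ?_
  simp only [tornheimTerm, Equiv.prodComm_apply, Prod.fst_swap, Prod.snd_swap]
  ring

theorem tornheim_zero_right {x y : ℝ} (hx : x * x = 1) (hy : y * y = 1) {p r : ℕ}
    (hp : 2 ≤ p) (hr : 2 ≤ r) :
    tornheim x y p r 0 = signedZeta x p * signedZeta y r := by
  have hs : Summable (fun ij : ℕ × ℕ => signedTerm x p ij.1 * signedTerm y r ij.2) :=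
    (summable_tornheimTerm hx hy (s := 0) (Or.inl ⟨hp, hr⟩)).congr fun ij => by
      simp only [tornheimTerm, signedTerm]; field_simp
  unfold signedZeta tornheim
  rw [(summable_signedTerm hx hp).tsum_mul_tsum (summable_signedTerm hy hr) hs]
  refine tsum_congr fun ij => ?_
  simp only [tornheimTerm, signedTerm]
  field_simp

/-- Group the pairs by n + m. Since y² = 1, y^m = y^(n+m) y^n, so the outer sign is y and the inner
sign is xy. -/
theorem tornheim_zero_middle {x y : ℝ} (hx : x * x = 1) (hy : y * y = 1) {p s : ℕ}
    (hp : 1 ≤ p) (hs : 2 ≤ s) :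
    tornheim x y p 0 s = doubleSum y s (x * y) p := by
  have hsum := summable_tornheimTerm hx hy (p := p) (r := 0) (s := s) (by omega)
  have hW := hasSum_doubleSum hy (mul_mul_self_eq_one hx hy) hs hp
  unfold tornheim
  -- The smallest value of n + m is 2, so the first term of the double sum, whose inner sum is
  -- empty, is split off.
  rw [← Finset.HasAntidiagonal.sigmaAntidiagonalEquivProd.tsum_eq,
    Summable.tsum_sigma (f := fun ij => tornheimTerm x y p 0 s (Finset.HasAntidiagonal.sigmaAntidiagonalEquivProd ij))
      ((Finset.HasAntidiagonal.sigmaAntidiagonalEquivProd.summable_iff).mpr hsum),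
    doubleSum, hW.summable.tsum_eq_zero_add, signedSum_zero, mul_zero, zero_add]
  refine tsum_congr fun d => ?_
  rw [tsum_fintype]
  simp only [Finset.HasAntidiagonal.sigmaAntidiagonalEquivProd_apply]
  rw [Finset.sum_coe_sort (antidiagonal d) (fun ij => tornheimTerm x y p 0 s ij),
    Finset.Nat.sum_antidiagonal_eq_sum_range_succ_mk, signedSum, Finset.mul_sum]
  refine sum_congr rfl fun i hi => ?_
  have hid : i ≤ d := by simpa [Nat.lt_succ_iff] using hi
  simp only [tornheimTerm, signedTerm]
  rw [Nat.cast_sub hid, mul_pow]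
  have e : y ^ (d - i + 1) = y ^ (d + 1 + 1) * y ^ (i + 1) := by
    have : d + 1 + 1 = (d - i + 1) + (i + 1) := by omega
    rw [this, pow_add y (d - i + 1), mul_assoc, pow_mul_pow_self hy, mul_one]
  rw [e]
  push_cast
  have : (i : ℝ) + (d - i) + 2 = d + 1 + 1 := by ring
  rw [this]
  field_simp

theorem tornheim_zero_left {x y : ℝ} (hx : x * x = 1) (hy : y * y = 1) {r s : ℕ}
    (hr : 1 ≤ r) (hs : 2 ≤ s) :
    tornheim x y 0 r s = doubleSum x s (x * y) r := by
  rw [tornheim_swap, tornheim_zero_middle hy hx hr hs, mul_comm]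

/-! ### Regularized values and summation over one index -/

/-- `c` acts as the (regularized) value of `∑ x ^ n / n`. -/
def IsRegularizedValue (x c : ℝ) : Prop :=
  ∀ m : ℕ, Tendsto (fun N => signedSum x 1 N - x ^ m * signedSum x 1 (N + m)) atTop
    (𝓝 (c - x ^ m * c))

theorem isRegularizedValue_of_tendsto {x c : ℝ} (h : Tendsto (signedSum x 1) atTop (𝓝 c)) :
    IsRegularizedValue x c := fun m =>
  h.sub ((h.comp (tendsto_add_atTop_nat m)).const_mul _)

/-- For x = 1 the divergent value enters only through c - c, so 0 is as good as any constant; the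
content is that H_{N+m} - H_N tends to 0. -/
theorem isRegularizedValue_one : IsRegularizedValue 1 0 := by
  intro m
  have h : ∀ N, signedSum 1 1 N - 1 ^ m * signedSum 1 1 (N + m)
      = ∑ i ∈ range m, -(1 / ((N : ℝ) + i + 1)) := by
    intro N
    induction m with
    | zero => simp
    | succ m ih =>
      rw [sum_range_succ, ← ih, ← add_assoc, signedSum_succ]
      simp only [signedTerm, one_pow]
      push_cast
      ring
  simp only [h, mul_zero, sub_zero]
  rw [show (0 : ℝ) = ∑ i ∈ range m, (0 : ℝ) by simp]
  refine tendsto_finsetSum _ fun i _ => ?_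
  rw [← neg_zero]
  refine Tendsto.neg ?_
  have := (tendsto_one_div_add_atTop_nhds_zero_nat (𝕜 := ℝ)).comp (tendsto_add_atTop_nat i)
  refine this.congr fun N => ?_
  simp

theorem sum_range_shift {x : ℝ} (hx : x * x = 1) (s m N : ℕ) :
    ∑ n ∈ range N, x ^ (n + 1) / ((m : ℝ) + n + 1) ^ s
      = x ^ m * (signedSum x s (N + m) - signedSum x s m) := by
  induction N with
  | zero => simp
  | succ N ih =>
    rw [sum_range_succ, ih, show N + 1 + m = N + m + 1 by ring, signedSum_succ]
    simp only [signedTerm]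
    push_cast
    have e : x ^ (N + 1) = x ^ m * x ^ (N + m + 1) := by
      rw [show N + m + 1 = m + (N + 1) by ring, pow_add x m (N + 1), ← mul_assoc,
        pow_mul_pow_self hx, one_mul]
    rw [e, show (N : ℝ) + m + 1 = m + N + 1 by ring]
    ring

theorem hasSum_shift {x : ℝ} (hx : x * x = 1) {s : ℕ} (hs : 2 ≤ s) (m : ℕ) :
    HasSum (fun n : ℕ => x ^ (n + 1) / ((m : ℝ) + n + 1) ^ s)
      (x ^ m * (signedZeta x s - signedSum x s m)) := by
  have hsum : Summable (fun n : ℕ => x ^ (n + 1) / ((m : ℝ) + n + 1) ^ s) := by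
    refine Summable.of_norm_bounded (summable_one_div_succ_pow hs) fun n => ?_
    rw [Real.norm_eq_abs, abs_div, abs_pow_of_mul_self hx, abs_of_pos (by positivity)]
    gcongr
    linarith [(Nat.cast_nonneg m : (0 : ℝ) ≤ m)]
  rw [hsum.hasSum_iff_tendsto_nat]
  simp only [sum_range_shift hx]
  exact (((tendsto_signedSum hx hs).comp (tendsto_add_atTop_nat m)).sub_const _).const_mul _

theorem hasSum_sub_shift {x c : ℝ} (hx : x * x = 1) (hc : IsRegularizedValue x c) (m : ℕ) :
    HasSum (fun n : ℕ => x ^ (n + 1) * (1 / ((n : ℝ) + 1) - 1 / ((m : ℝ) + n + 1)))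
      (c - x ^ m * (c - signedSum x 1 m)) := by
  have hsum : Summable
      (fun n : ℕ => x ^ (n + 1) * (1 / ((n : ℝ) + 1) - 1 / ((m : ℝ) + n + 1))) := by
    refine Summable.of_norm_bounded
      ((summable_one_div_succ_pow le_rfl).mul_left (m : ℝ)) fun n => ?_
    rw [Real.norm_eq_abs, abs_mul, abs_pow_of_mul_self hx, one_mul]
    have : 1 / ((n : ℝ) + 1) - 1 / ((m : ℝ) + n + 1)
        = m * (1 / (((n : ℝ) + 1) * ((m : ℝ) + n + 1))) := by field_simp; ring
    rw [this, abs_of_nonneg (by positivity), sq]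
    gcongr
    linarith [(Nat.cast_nonneg m : (0 : ℝ) ≤ m)]
  rw [hsum.hasSum_iff_tendsto_nat]
  have h := (hc m).add_const (x ^ m * signedSum x 1 m)
  rw [show c - x ^ m * c + x ^ m * signedSum x 1 m = c - x ^ m * (c - signedSum x 1 m) by ring] at h
  refine h.congr fun N => ?_
  have e1 := sum_range_shift hx 1 m N
  have e2 : ∑ n ∈ range N, x ^ (n + 1) * (1 / ((n : ℝ) + 1)) = signedSum x 1 N := by
    simp [signedSum, signedTerm, div_eq_mul_inv]
  simp only [mul_sub, sum_sub_distrib, e2]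
  simp only [pow_one] at e1
  simp only [mul_one_div, e1]
  ring

/-- Evaluation of `∑ x ^ n y ^ m / (n m ^ r (n + m))` by summing over `n` first. -/
theorem tornheim_one_one {x y c : ℝ} (hx : x * x = 1) (hy : y * y = 1)
    (hc : IsRegularizedValue x c) {r : ℕ} (hr : 1 ≤ r) :
    tornheim x y 1 r 1 = c * signedZeta y (r + 1) - c * signedZeta (x * y) (r + 1)
      + doubleSum (x * y) (r + 1) x 1 + signedZeta y (r + 2) := by
  have hxy := mul_mul_self_eq_one hx hy
  have hs := summable_tornheimTerm hx hy (p := 1) (r := r) (s := 1) (by omega)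
  rw [tornheim, ← (Equiv.prodComm ℕ ℕ).tsum_eq,
    Summable.tsum_prod (f := fun ij => tornheimTerm x y 1 r 1 ((Equiv.prodComm ℕ ℕ) ij))
      ((Equiv.prodComm ℕ ℕ).summable_iff.mpr hs)]
  -- Uses 1/(n(n+m)) = (1/n - 1/(n+m))/m, then the regularized sum over n.
  have inner : ∀ m : ℕ, HasSum (fun n => tornheimTerm x y 1 r 1 ((Equiv.prodComm ℕ ℕ) (m, n)))
      (y ^ (m + 1) / ((m : ℝ) + 1) ^ (r + 1)
        * (c - x ^ (m + 1) * (c - signedSum x 1 (m + 1)))) := by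
    intro m
    refine ((hasSum_sub_shift hx hc (m + 1)).mul_left
      (y ^ (m + 1) / ((m : ℝ) + 1) ^ (r + 1))).congr_fun fun n => ?_
    simp only [tornheimTerm, Equiv.prodComm_apply, Prod.swap_prod_mk]
    push_cast
    rw [show (m : ℝ) + 1 + n + 1 = n + m + 2 by ring]
    field_simp
    ring
  have h := ((((hasSum_signedTerm hy (by omega : 2 ≤ r + 1)).mul_left c).sub
    ((hasSum_signedTerm hxy (by omega : 2 ≤ r + 1)).mul_left c)).add
    (hasSum_doubleSum hxy hx (by omega : 2 ≤ r + 1) le_rfl)).add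
    (hasSum_signedTerm hy (by omega : 2 ≤ r + 2))
  rw [← h.tsum_eq]
  refine tsum_congr fun m => ?_
  rw [(inner m).tsum_eq, signedSum_succ]
  simp only [signedTerm, mul_pow]
  have := pow_mul_pow_self hx (m + 1)
  field_simp
  linear_combination y ^ (m + 1) * ((m : ℝ) + 1) ^ (r + 2) * this

/-! ### The shift kernel and passage to the limit -/

/-- The sum over `n ≥ 1` of `x ^ n / n ^ q * (1 / (m + n) ^ a - 1 / m ^ a)`, at `m + 1`. -/
noncomputable def shiftKernel (x : ℝ) (q a m : ℕ) : ℝ :=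
  ∑' n : ℕ, signedTerm x q n * (1 / ((m : ℝ) + 1 + (n + 1 : ℕ)) ^ a - 1 / ((m : ℝ) + 1) ^ a)

theorem pow_sub_pow_le_mul_sub {u v : ℝ} (hv : 0 ≤ v) (huv : v ≤ u) (hu : u ≤ 1) (a : ℕ) :
    u ^ a - v ^ a ≤ a * (u - v) := by
  induction a with
  | zero => simp
  | succ a ih =>
    have h1 : v ^ a ≤ 1 := pow_le_one₀ hv (huv.trans hu)
    have h2 : v ^ a ≤ u ^ a := pow_le_pow_left₀ hv huv a
    push_cast
    calc u ^ (a + 1) - v ^ (a + 1) = u * (u ^ a - v ^ a) + v ^ a * (u - v) := by ring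
      _ ≤ 1 * (u ^ a - v ^ a) + 1 * (u - v) := by gcongr
      _ ≤ _ := by linarith

/-- Subtracting 1/m^a gains decay 1/m² at the price of a factor n; `q ≥ 3` pays for that factor and
keeps 1/n². -/
theorem abs_signedTerm_mul_sub_le {x : ℝ} (hx : x * x = 1) {q : ℕ} (hq : 3 ≤ q) (a m n : ℕ) :
    |signedTerm x q n * (1 / ((m : ℝ) + 1 + (n + 1 : ℕ)) ^ a - 1 / ((m : ℝ) + 1) ^ a)|
      ≤ a * (1 / ((m : ℝ) + 1) ^ 2) * (1 / ((n : ℝ) + 1) ^ 2) := by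
  have hm : (0 : ℝ) ≤ m := m.cast_nonneg
  have hn : (0 : ℝ) ≤ n := n.cast_nonneg
  have huv : 1 / ((m : ℝ) + 1 + (n + 1 : ℕ)) ≤ 1 / ((m : ℝ) + 1) := by
    gcongr <;> push_cast <;> linarith
  have hu : 1 / ((m : ℝ) + 1) ≤ 1 := by
    rw [div_le_one (by positivity)]; linarith
  have h := pow_sub_pow_le_mul_sub (by positivity) huv hu a
  have h' := pow_le_pow_left₀ (by positivity) huv a
  simp only [one_div_pow] at h h'
  have hd : 1 / ((m : ℝ) + 1) - 1 / ((m : ℝ) + 1 + (n + 1 : ℕ))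
      ≤ (n + 1) * (1 / ((m : ℝ) + 1) ^ 2) := by
    have : 1 / ((m : ℝ) + 1) - 1 / ((m : ℝ) + 1 + (n + 1 : ℕ))
        = (n + 1) * (1 / (((m : ℝ) + 1) * ((m : ℝ) + 1 + (n + 1 : ℕ)))) := by
      push_cast; field_simp; ring
    rw [this, sq]
    gcongr <;> push_cast <;> linarith
  have hc : 1 / ((n : ℝ) + 1) ^ q ≤ 1 / ((n : ℝ) + 1) ^ 3 := by
    apply one_div_le_one_div_of_le (by positivity)
    exact pow_le_pow_right₀ (by linarith) hq
  rw [abs_mul, abs_signedTerm hx, abs_sub_comm, abs_of_nonneg (by linarith)]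
  calc _ ≤ 1 / ((n : ℝ) + 1) ^ 3 * (a * ((n + 1) * (1 / ((m : ℝ) + 1) ^ 2))) := by
        refine mul_le_mul hc (h.trans ?_) (by linarith) (by positivity)
        gcongr
    _ = _ := by field_simp

theorem hasSum_shiftKernel {x : ℝ} (hx : x * x = 1) {q : ℕ} (hq : 3 ≤ q) (a m : ℕ) :
    HasSum (fun n : ℕ => signedTerm x q n *
      (1 / ((m : ℝ) + 1 + (n + 1 : ℕ)) ^ a - 1 / ((m : ℝ) + 1) ^ a)) (shiftKernel x q a m) :=
  (Summable.of_norm_bounded ((summable_one_div_succ_pow le_rfl).mul_left _)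
    (abs_signedTerm_mul_sub_le hx hq a m)).hasSum

theorem abs_shiftKernel_le {x : ℝ} (hx : x * x = 1) {q : ℕ} (hq : 3 ≤ q) (a m : ℕ) :
    |shiftKernel x q a m|
      ≤ a * (1 / ((m : ℝ) + 1) ^ 2) * ∑' n : ℕ, 1 / ((n : ℝ) + 1) ^ 2 := by
  have h := (summable_one_div_succ_pow le_rfl).hasSum.mul_left (a * (1 / ((m : ℝ) + 1) ^ 2))
  exact (hasSum_shiftKernel hx hq a m).norm_le_of_bounded h
    (abs_signedTerm_mul_sub_le hx hq a m)

/-- Passing to the limit in finite partial fraction expansions with bounded coefficients, after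
summing against `x ^ n / n ^ q`. -/
theorem hasSum_sub_shiftKernel {x : ℝ} (hx : x * x = 1) {q : ℕ} (hq : 3 ≤ q)
    {f : ℕ → ℕ → ℝ} {F : ℕ → ℝ} {D₁ D₂ D₃ : ℕ → ℕ → ℝ} {E₁ E₂ E₃ : ℕ → ℝ} {K : ℝ}
    (hf : ∀ N n, f N n = ∑ m ∈ range N, (D₁ N m * (1 / ((m : ℝ) + 1 + n) ^ 1)
      + D₂ N m * (1 / ((m : ℝ) + 1 + n) ^ 2) + D₃ N m * (1 / ((m : ℝ) + 1 + n) ^ 3)))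
    (hfK : ∀ N n, |f N n| ≤ K)
    (h₁K : ∀ N m, m < N → |D₁ N m| ≤ K) (h₂K : ∀ N m, m < N → |D₂ N m| ≤ K)
    (h₃K : ∀ N m, m < N → |D₃ N m| ≤ K)
    (hF : ∀ n, Tendsto (fun N => f N n) atTop (𝓝 (F n)))
    (h₁ : ∀ m, Tendsto (fun N => D₁ N m) atTop (𝓝 (E₁ m)))
    (h₂ : ∀ m, Tendsto (fun N => D₂ N m) atTop (𝓝 (E₂ m)))
    (h₃ : ∀ m, Tendsto (fun N => D₃ N m) atTop (𝓝 (E₃ m))) :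
    HasSum (fun m => signedTerm x q m * (F (m + 1) - F 0) - (E₁ m * shiftKernel x q 1 m
      + E₂ m * shiftKernel x q 2 m + E₃ m * shiftKernel x q 3 m)) 0 := by
  set κ := shiftKernel x q with hκ
  set Z := ∑' n : ℕ, 1 / ((n : ℝ) + 1) ^ 2 with hZ
  have hK : 0 ≤ K := (abs_nonneg _).trans (hfK 0 0)
  have hZ0 : 0 ≤ Z := tsum_nonneg fun n => by positivity
  have bound : ∀ m {d₁ d₂ d₃ : ℝ}, |d₁| ≤ K → |d₂| ≤ K → |d₃| ≤ K →
      |d₁ * κ 1 m + d₂ * κ 2 m + d₃ * κ 3 m| ≤ 6 * K * Z * (1 / ((m : ℝ) + 1) ^ 2) := by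
    intro m d₁ d₂ d₃ hd₁ hd₂ hd₃
    have b1 := abs_shiftKernel_le hx hq 1 m
    have b2 := abs_shiftKernel_le hx hq 2 m
    have b3 := abs_shiftKernel_le hx hq 3 m
    rw [← hκ, ← hZ] at b1 b2 b3
    have t1 : |d₁ * κ 1 m| ≤ K * (1 * (1 / ((m : ℝ) + 1) ^ 2) * Z) := by
      rw [abs_mul]; gcongr; simpa using b1
    have t2 : |d₂ * κ 2 m| ≤ K * (2 * (1 / ((m : ℝ) + 1) ^ 2) * Z) := by
      rw [abs_mul]; gcongr; simpa using b2
    have t3 : |d₃ * κ 3 m| ≤ K * (3 * (1 / ((m : ℝ) + 1) ^ 2) * Z) := by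
      rw [abs_mul]; gcongr; simpa using b3
    refine (abs_add_three _ _ _).trans ?_
    linarith
  have hleftBound : Summable (fun n : ℕ => 1 / ((n : ℝ) + 1) ^ q * (K + K)) :=
    (summable_one_div_succ_pow (by omega)).mul_right _
  have hrightBound : Summable (fun m : ℕ => 6 * K * Z * (1 / ((m : ℝ) + 1) ^ 2)) :=
    (summable_one_div_succ_pow le_rfl).mul_left _
  -- The coefficients are only bounded, so the limit in N cannot be taken in ∑ 1/(m+n). Subtracting
  -- the value at n = 0 makes both orders of summation dominated.
  have hleft : Tendsto (fun N => ∑' n, signedTerm x q n * (f N (n + 1) - f N 0)) atTop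
      (𝓝 (∑' n, signedTerm x q n * (F (n + 1) - F 0))) := by
    refine tendsto_tsum_of_dominated_convergence hleftBound
      (fun n => ((hF (n + 1)).sub (hF 0)).const_mul _) (Eventually.of_forall fun N n => ?_)
    rw [Real.norm_eq_abs, abs_mul, abs_signedTerm hx]
    gcongr
    exact (abs_sub _ _).trans (add_le_add (hfK _ _) (hfK _ _))
  have hleftSum : Summable (fun n => signedTerm x q n * (F (n + 1) - F 0)) := by
    have hFK : ∀ n, |F n| ≤ K := fun n =>
      le_of_tendsto (hF n).abs (Eventually.of_forall fun N => hfK N n)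
    refine Summable.of_norm_bounded hleftBound fun n => ?_
    rw [Real.norm_eq_abs, abs_mul, abs_signedTerm hx]
    gcongr
    exact (abs_sub _ _).trans (add_le_add (hFK _) (hFK _))
  have hright : Tendsto (fun N => ∑' m, if m < N then
        (D₁ N m * κ 1 m + D₂ N m * κ 2 m + D₃ N m * κ 3 m) else 0) atTop
      (𝓝 (∑' m, (E₁ m * κ 1 m + E₂ m * κ 2 m + E₃ m * κ 3 m))) := by
    refine tendsto_tsum_of_dominated_convergence hrightBound (fun m => ?_)
      (Eventually.of_forall fun N m => ?_)
    · have h := (((h₁ m).mul_const (κ 1 m)).add ((h₂ m).mul_const (κ 2 m))).add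
        ((h₃ m).mul_const (κ 3 m))
      refine h.congr' ?_
      filter_upwards [eventually_gt_atTop m] with N hN
      rw [if_pos hN]
    · rw [Real.norm_eq_abs]
      split_ifs with hN
      · exact bound m (h₁K N m hN) (h₂K N m hN) (h₃K N m hN)
      · rw [abs_zero]; positivity
  have hrightSum : Summable (fun m => E₁ m * κ 1 m + E₂ m * κ 2 m + E₃ m * κ 3 m) := by
    have lim : ∀ {D : ℕ → ℕ → ℝ} {E : ℕ → ℝ} (_ : ∀ N m, m < N → |D N m| ≤ K)
        (_ : ∀ m, Tendsto (fun N => D N m) atTop (𝓝 (E m))) (m), |E m| ≤ K :=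
      fun hD hE m => le_of_tendsto (hE m).abs
        ((eventually_gt_atTop m).mono fun N hN => hD N m hN)
    exact Summable.of_norm_bounded hrightBound fun m =>
      bound m (lim h₁K h₁ m) (lim h₂K h₂ m) (lim h₃K h₃ m)
  -- Both sides are series over one index, so their difference can be stated as a single series with
  -- sum 0 and later matched term by term.
  suffices h : ∑' n, signedTerm x q n * (F (n + 1) - F 0)
      = ∑' m, (E₁ m * κ 1 m + E₂ m * κ 2 m + E₃ m * κ 3 m) by
    simpa [h] using hleftSum.hasSum.sub hrightSum.hasSum
  refine tendsto_nhds_unique hleft (hright.congr fun N => ?_)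
  rw [tsum_eq_sum (s := range N) (fun m hm => if_neg (by simpa using hm))]
  have hfin : HasSum (fun n => ∑ m ∈ range N,
      (D₁ N m * (signedTerm x q n *
          (1 / ((m : ℝ) + 1 + (n + 1 : ℕ)) ^ 1 - 1 / ((m : ℝ) + 1) ^ 1))
        + D₂ N m * (signedTerm x q n *
          (1 / ((m : ℝ) + 1 + (n + 1 : ℕ)) ^ 2 - 1 / ((m : ℝ) + 1) ^ 2))
        + D₃ N m * (signedTerm x q n *
          (1 / ((m : ℝ) + 1 + (n + 1 : ℕ)) ^ 3 - 1 / ((m : ℝ) + 1) ^ 3))))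
      (∑ m ∈ range N, (D₁ N m * κ 1 m + D₂ N m * κ 2 m + D₃ N m * κ 3 m)) :=
    hasSum_sum fun m _ => (((hasSum_shiftKernel hx hq 1 m).mul_left _).add
      ((hasSum_shiftKernel hx hq 2 m).mul_left _)).add
      ((hasSum_shiftKernel hx hq 3 m).mul_left _)
  rw [sum_congr rfl fun m hm => if_pos (mem_range.mp hm), ← hfin.tsum_eq]
  refine tsum_congr fun n => ?_
  rw [hf, hf, ← sum_sub_distrib, mul_sum]
  refine sum_congr rfl fun m _ => ?_
  rw [Nat.cast_zero, add_zero]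
  ring

/-! ### Partial fractions of products of tails -/

/-- The sum of `w ^ j / (j - m) ^ b` over `1 ≤ j ≤ N` with the index equal to `m` left out
(both indices shifted by one). -/
noncomputable def puncturedSum (w : ℝ) (b N m : ℕ) : ℝ :=
  ∑ j ∈ range N, if j = m then 0 else w ^ (j + 1) / ((j : ℝ) - m) ^ b

/-- Split at j = m. The terms above give a partial sum of length d; reflecting those below gives one
of length m with the parity sign (-1)^b. -/
theorem puncturedSum_eq {w : ℝ} (hw : w * w = 1) (b m d : ℕ) :
    puncturedSum w b (m + 1 + d) m
      = w ^ (m + 1) * (signedSum w b d + (-1) ^ b * signedSum w b m) := by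
  rw [puncturedSum, sum_range_add, sum_range_succ, if_pos rfl, add_zero, mul_add, add_comm]
  congr 1
  · rw [signedSum, mul_sum]
    refine sum_congr rfl fun i _ => ?_
    rw [if_neg (by omega), signedTerm]
    push_cast
    rw [show (m : ℝ) + 1 + i - m = i + 1 by ring]
    ring
  · rw [← sum_range_reflect, signedSum, mul_sum, mul_sum]
    refine sum_congr rfl fun i hi => ?_
    have him : i < m := by simpa using hi
    rw [if_neg (by omega), signedTerm, Nat.sub_right_comm, Nat.cast_sub (by omega),
      Nat.cast_sub (by omega)]
    have e : w ^ (m - i - 1 + 1) = w ^ (m + 1) * w ^ (i + 1) := by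
      rw [show m + 1 = (m - i - 1 + 1) + (i + 1) by omega, pow_add w (m - i - 1 + 1), mul_assoc,
        pow_mul_pow_self hw, mul_one]
    rw [e, show (m : ℝ) - i - (1 : ℕ) - m = (-1) * (i + 1) by push_cast; ring, mul_pow]
    have : (-1 : ℝ) ^ b * (-1) ^ b = 1 := pow_mul_pow_self (by norm_num) b
    have h0 : (-1 : ℝ) ^ b ≠ 0 := by positivity
    field_simp
    linear_combination -w ^ (m + 1) * w ^ (i + 1) * this

theorem tendsto_puncturedSum {w z : ℝ} (hw : w * w = 1) {b : ℕ}
    (hz : Tendsto (signedSum w b) atTop (𝓝 z)) (m : ℕ) :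
    Tendsto (fun N => puncturedSum w b N m) atTop
      (𝓝 (w ^ (m + 1) * (z + (-1) ^ b * signedSum w b m))) := by
  rw [← tendsto_add_atTop_iff_nat (m + 1)]
  simp only [add_comm _ (m + 1), puncturedSum_eq hw]
  exact (hz.add_const _).const_mul _

theorem exists_abs_signedSum_le {w z : ℝ} {b : ℕ}
    (hz : Tendsto (signedSum w b) atTop (𝓝 z)) : ∃ K, ∀ n, |signedSum w b n| ≤ K := by
  obtain ⟨K, hK⟩ := (Metric.isBounded_range_of_tendsto _ hz).exists_norm_le
  exact ⟨K, fun n => hK _ ⟨n, rfl⟩⟩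

theorem abs_puncturedSum_le {w K : ℝ} (hw : w * w = 1) {b : ℕ}
    (hK : ∀ n, |signedSum w b n| ≤ K) {N m : ℕ} (h : m < N) :
    |puncturedSum w b N m| ≤ 2 * K := by
  obtain ⟨d, rfl⟩ := Nat.exists_eq_add_of_le (Nat.succ_le_of_lt h)
  rw [Nat.succ_eq_add_one, puncturedSum_eq hw, abs_mul, abs_pow_of_mul_self hw, one_mul]
  refine (abs_add_le _ _).trans ?_
  rw [abs_mul, abs_pow, abs_neg, abs_one, one_pow, one_mul]
  linarith [hK d, hK m]

/-- The finite sum over `1 ≤ k ≤ N` of `y ^ k / (k + n) ^ a`. -/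
noncomputable def shiftedSum (y : ℝ) (a N n : ℕ) : ℝ :=
  ∑ k ∈ range N, y ^ (k + 1) / ((n : ℝ) + k + 1) ^ a

theorem abs_shiftedSum_le {y K : ℝ} (hy : y * y = 1) {a : ℕ}
    (hK : ∀ n, |signedSum y a n| ≤ K) (N n : ℕ) : |shiftedSum y a N n| ≤ 2 * K := by
  rw [shiftedSum, sum_range_shift hy, abs_mul, abs_pow_of_mul_self hy, one_mul]
  exact (abs_sub _ _).trans (by linarith [hK (N + n), hK n])

theorem tendsto_shiftedSum {y z : ℝ} (hy : y * y = 1) {a : ℕ}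
    (hz : Tendsto (signedSum y a) atTop (𝓝 z)) (n : ℕ) :
    Tendsto (fun N => shiftedSum y a N n) atTop (𝓝 (y ^ n * (z - signedSum y a n))) := by
  simp only [shiftedSum, sum_range_shift hy]
  exact ((hz.comp (tendsto_add_atTop_nat n)).sub_const _).const_mul _

/-- Regroups a double sum by the location m of the pole: `d` is the diagonal, `u` and `v` are the
parts of each off-diagonal term with pole at the first or second index. -/
theorem sum_mul_sum_split {N : ℕ} {s t d : ℕ → ℝ} {u v : ℕ → ℕ → ℝ}
    (hd : ∀ k, s k * t k = d k)
    (huv : ∀ k j, k ≠ j → s k * t j = u k j + v j k) :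
    (∑ k ∈ range N, s k) * ∑ j ∈ range N, t j
      = ∑ m ∈ range N, (d m + (∑ j ∈ range N, if j = m then 0 else u m j)
          + ∑ k ∈ range N, if k = m then 0 else v m k) := by
  have h : ∀ k ∈ range N, ∀ j ∈ range N, s k * t j
      = ((if j = k then d k else 0) + (if j = k then 0 else u k j)) + if k = j then 0 else v j k := by
    intro k _ j _
    by_cases hkj : k = j
    · subst hkj; simp [hd]
    · simp [hkj, Ne.symm hkj, huv k j hkj]
  rw [sum_mul_sum, sum_congr rfl fun k hk => sum_congr rfl (h k hk)]
  simp only [sum_add_distrib]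
  rw [sum_comm (f := fun k j => if k = j then (0 : ℝ) else v j k)]
  congr 2
  refine sum_congr rfl fun k hk => ?_
  rw [sum_ite_eq' (range N) k, if_pos hk]

theorem shiftedSum_mul_shiftedSum_one_one (y w : ℝ) (N n : ℕ) :
    shiftedSum y 1 N n * shiftedSum w 1 N n = ∑ m ∈ range N,
      ((y ^ (m + 1) * puncturedSum w 1 N m + w ^ (m + 1) * puncturedSum y 1 N m)
          * (1 / ((m : ℝ) + 1 + n) ^ 1)
        + (y * w) ^ (m + 1) * (1 / ((m : ℝ) + 1 + n) ^ 2) + 0 * (1 / ((m : ℝ) + 1 + n) ^ 3)) := by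
  unfold shiftedSum puncturedSum
  rw [sum_mul_sum_split (N := N)
    (d := fun m => (y * w) ^ (m + 1) * (1 / ((m : ℝ) + 1 + n) ^ 2))
    (u := fun k j => y ^ (k + 1) * (1 / ((k : ℝ) + 1 + n)) * (w ^ (j + 1) / ((j : ℝ) - k) ^ 1))
    (v := fun j k => w ^ (j + 1) * (1 / ((j : ℝ) + 1 + n)) * (y ^ (k + 1) / ((k : ℝ) - j) ^ 1))]
  · refine sum_congr rfl fun m _ => ?_
    have e : ∀ (a c : ℝ) (g : ℕ → ℝ), a * (∑ j ∈ range N, if j = m then 0 else g j) * c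
        = ∑ j ∈ range N, if j = m then 0 else a * c * g j := by
      intro a c g
      rw [mul_sum, sum_mul]
      refine sum_congr rfl fun j _ => ?_
      split_ifs <;> ring
    rw [add_mul, e, e]
    simp only [pow_one]
    ring
  · intro k
    rw [mul_pow]
    field_simp
    ring
  · intro k j hkj
    have h : (j : ℝ) - k ≠ 0 := sub_ne_zero.mpr (by exact_mod_cast hkj.symm)
    have h' : (k : ℝ) - j ≠ 0 := sub_ne_zero.mpr (by exact_mod_cast hkj)
    have h1 : (n : ℝ) + k + 1 ≠ 0 := by positivity
    have h2 : (n : ℝ) + j + 1 ≠ 0 := by positivity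
    rw [show (k : ℝ) + 1 + n = n + k + 1 by ring, show (j : ℝ) + 1 + n = n + j + 1 by ring,
      show (k : ℝ) - j = -(j - k) by ring]
    field_simp
    ring

theorem shiftedSum_mul_shiftedSum_two_one (y w : ℝ) (N n : ℕ) :
    shiftedSum y 2 N n * shiftedSum w 1 N n = ∑ m ∈ range N,
      ((w ^ (m + 1) * puncturedSum y 2 N m - y ^ (m + 1) * puncturedSum w 2 N m)
          * (1 / ((m : ℝ) + 1 + n) ^ 1)
        + y ^ (m + 1) * puncturedSum w 1 N m * (1 / ((m : ℝ) + 1 + n) ^ 2)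
        + (y * w) ^ (m + 1) * (1 / ((m : ℝ) + 1 + n) ^ 3)) := by
  unfold shiftedSum puncturedSum
  rw [sum_mul_sum_split (N := N)
    (d := fun m => (y * w) ^ (m + 1) * (1 / ((m : ℝ) + 1 + n) ^ 3))
    (u := fun k j => y ^ (k + 1) * (1 / ((k : ℝ) + 1 + n) ^ 2) * (w ^ (j + 1) / ((j : ℝ) - k) ^ 1)
      + -(y ^ (k + 1) * (1 / ((k : ℝ) + 1 + n)) * (w ^ (j + 1) / ((j : ℝ) - k) ^ 2)))
    (v := fun j k => w ^ (j + 1) * (1 / ((j : ℝ) + 1 + n)) * (y ^ (k + 1) / ((k : ℝ) - j) ^ 2))]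
  · refine sum_congr rfl fun m _ => ?_
    have e : ∀ (a c : ℝ) (g : ℕ → ℝ), a * (∑ j ∈ range N, if j = m then 0 else g j) * c
        = ∑ j ∈ range N, if j = m then 0 else a * c * g j := by
      intro a c g
      rw [mul_sum, sum_mul]
      refine sum_congr rfl fun j _ => ?_
      split_ifs <;> ring
    have e' : ∀ g g' : ℕ → ℝ, (∑ j ∈ range N, if j = m then 0 else g j + -g' j)
        = (∑ j ∈ range N, if j = m then 0 else g j) - ∑ j ∈ range N, if j = m then 0 else g' j := by
      intro g g'
      rw [← sum_sub_distrib]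
      refine sum_congr rfl fun j _ => ?_
      split_ifs <;> ring
    rw [sub_mul, e, e, e, e']
    simp only [pow_one]
    ring
  · intro k
    rw [mul_pow]
    field_simp
    ring
  · intro k j hkj
    have h : (j : ℝ) - k ≠ 0 := sub_ne_zero.mpr (by exact_mod_cast hkj.symm)
    have h1 : (n : ℝ) + k + 1 ≠ 0 := by positivity
    have h2 : (n : ℝ) + j + 1 ≠ 0 := by positivity
    rw [show (k : ℝ) + 1 + n = n + k + 1 by ring, show (j : ℝ) + 1 + n = n + j + 1 by ring,
      show (k : ℝ) - j = -(j - k) by ring]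
    field_simp
    ring

theorem hasSum_shiftedSum_one_one {x y w z z' : ℝ} (hx : x * x = 1) (hy : y * y = 1)
    (hw : w * w = 1) {q : ℕ} (hq : 3 ≤ q) (hz : Tendsto (signedSum y 1) atTop (𝓝 z))
    (hz' : Tendsto (signedSum w 1) atTop (𝓝 z')) :
    HasSum (fun m => signedTerm x q m * (y ^ (m + 1) * (z - signedSum y 1 (m + 1))
          * (w ^ (m + 1) * (z' - signedSum w 1 (m + 1))) - z * z')
      - (y ^ (m + 1) * w ^ (m + 1) * (z' - signedSum w 1 m + (z - signedSum y 1 m))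
          * shiftKernel x q 1 m + (y * w) ^ (m + 1) * shiftKernel x q 2 m)) 0 := by
  obtain ⟨K, hK⟩ := exists_abs_signedSum_le hz
  obtain ⟨K', hK'⟩ := exists_abs_signedSum_le hz'
  have hK0 : 0 ≤ K := (abs_nonneg _).trans (hK 0)
  have hK0' : 0 ≤ K' := (abs_nonneg _).trans (hK' 0)
  -- One constant for all bounds: (2K)(2K') for the product of tails, 2K + 2K' for the simple-pole
  -- coefficient, 1 for the sign at the double pole.
  have h := hasSum_sub_shiftKernel hx hq (K := 4 * (K * K') + 2 * K + 2 * K' + 1)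
    (shiftedSum_mul_shiftedSum_one_one y w) (fun N n => ?_) (fun N m hm => ?_)
    (fun N m _ => ?_) (fun N m _ => ?_)
    (fun n => (tendsto_shiftedSum hy hz n).mul (tendsto_shiftedSum hw hz' n))
    (fun m => ((tendsto_puncturedSum hw hz' m).const_mul _).add
      ((tendsto_puncturedSum hy hz m).const_mul _))
    (fun m => tendsto_const_nhds) (fun m => tendsto_const_nhds)
  · refine h.congr_fun fun m => ?_
    simp only [pow_zero, signedSum_zero, mul_pow]
    ring
  · rw [abs_mul]
    calc _ ≤ (2 * K) * (2 * K') := by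
          gcongr
          exacts [abs_shiftedSum_le hy hK N n, abs_shiftedSum_le hw hK' N n]
      _ ≤ _ := by linarith
  · refine (abs_add_le _ _).trans ?_
    rw [abs_mul, abs_mul, abs_pow_of_mul_self hy, abs_pow_of_mul_self hw]
    linarith [abs_puncturedSum_le hy hK hm, abs_puncturedSum_le hw hK' hm, mul_nonneg hK0 hK0']
  · rw [abs_pow_of_mul_self (mul_mul_self_eq_one hy hw)]
    linarith [mul_nonneg hK0 hK0']
  · rw [abs_zero]; positivity

theorem hasSum_shiftedSum_two_one {x y w z' : ℝ} (hx : x * x = 1) (hy : y * y = 1)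
    (hw : w * w = 1) {q : ℕ} (hq : 3 ≤ q) (hz' : Tendsto (signedSum w 1) atTop (𝓝 z')) :
    HasSum (fun m => signedTerm x q m * (y ^ (m + 1) * (signedZeta y 2 - signedSum y 2 (m + 1))
          * (w ^ (m + 1) * (z' - signedSum w 1 (m + 1))) - signedZeta y 2 * z')
      - (y ^ (m + 1) * w ^ (m + 1) * (signedZeta y 2 + signedSum y 2 m
            - (signedZeta w 2 + signedSum w 2 m)) * shiftKernel x q 1 m
          + y ^ (m + 1) * w ^ (m + 1) * (z' - signedSum w 1 m) * shiftKernel x q 2 m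
          + (y * w) ^ (m + 1) * shiftKernel x q 3 m)) 0 := by
  have hz := tendsto_signedSum hy (le_refl 2)
  have hv := tendsto_signedSum hw (le_refl 2)
  obtain ⟨K, hK⟩ := exists_abs_signedSum_le hz
  obtain ⟨K', hK'⟩ := exists_abs_signedSum_le hz'
  obtain ⟨K'', hK''⟩ := exists_abs_signedSum_le hv
  have hK0 : 0 ≤ K := (abs_nonneg _).trans (hK 0)
  have hK0' : 0 ≤ K' := (abs_nonneg _).trans (hK' 0)
  have hK0'' : 0 ≤ K'' := (abs_nonneg _).trans (hK'' 0)
  have h := hasSum_sub_shiftKernel hx hq (K := 4 * (K * K') + 2 * K + 2 * K' + 2 * K'' + 1)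
    (shiftedSum_mul_shiftedSum_two_one y w) (fun N n => ?_) (fun N m hm => ?_)
    (fun N m hm => ?_) (fun N m _ => ?_)
    (fun n => (tendsto_shiftedSum hy hz n).mul (tendsto_shiftedSum hw hz' n))
    (fun m => ((tendsto_puncturedSum hy hz m).const_mul _).sub
      ((tendsto_puncturedSum hw hv m).const_mul _))
    (fun m => (tendsto_puncturedSum hw hz' m).const_mul _) (fun m => tendsto_const_nhds)
  · refine h.congr_fun fun m => ?_
    simp only [pow_zero, signedSum_zero, mul_pow]
    ring
  · rw [abs_mul]
    calc _ ≤ (2 * K) * (2 * K') := by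
          gcongr
          exacts [abs_shiftedSum_le hy hK N n, abs_shiftedSum_le hw hK' N n]
      _ ≤ _ := by linarith
  · refine (abs_sub _ _).trans ?_
    rw [abs_mul, abs_mul, abs_pow_of_mul_self hy, abs_pow_of_mul_self hw]
    linarith [abs_puncturedSum_le hy hK hm, abs_puncturedSum_le hw hK'' hm, mul_nonneg hK0 hK0']
  · rw [abs_mul, abs_pow_of_mul_self hy]
    linarith [abs_puncturedSum_le hw hK' hm, mul_nonneg hK0 hK0']
  · rw [abs_pow_of_mul_self (mul_mul_self_eq_one hy hw)]
    linarith [mul_nonneg hK0 hK0']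

/-! ### Closed forms of the shift kernel -/

theorem hasSum_shift_succ {x : ℝ} (hx : x * x = 1) {s : ℕ} (hs : 2 ≤ s) (m : ℕ) :
    HasSum (fun n : ℕ => x ^ (n + 1) * (1 / ((m : ℝ) + 1 + (n + 1 : ℕ)) ^ s))
      (x ^ (m + 1) * (signedZeta x s - signedSum x s (m + 1))) :=
  (hasSum_shift hx hs (m + 1)).congr_fun fun n => by push_cast; ring_nf

theorem hasSum_sub_shift_succ {x c : ℝ} (hx : x * x = 1) (hc : IsRegularizedValue x c) (m : ℕ) :
    HasSum (fun n : ℕ => x ^ (n + 1) * (1 / ((n : ℝ) + 1) - 1 / ((m : ℝ) + 1 + (n + 1 : ℕ))))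
      (c - x ^ (m + 1) * (c - signedSum x 1 (m + 1))) :=
  (hasSum_sub_shift hx hc (m + 1)).congr_fun fun n => by push_cast; ring_nf

/-- Partial fractions in n of n^(-q)((m+n)^(-a) - m^(-a)). The simple poles at 0 and -m have
opposite residues and combine into 1/n - 1/(m+n), which is why only a regularized value `c` is
needed. The other kernels are computed the same way. -/
theorem shiftKernel_three_one {x c : ℝ} (hx : x * x = 1) (hc : IsRegularizedValue x c)
    (m : ℕ) : shiftKernel x 3 1 m =
    -(1 / ((m : ℝ) + 1) ^ 2) * signedZeta x 2
      + 1 / ((m : ℝ) + 1) ^ 3 * (c - x ^ (m + 1) * (c - signedSum x 1 (m + 1))) := by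
  refine (hasSum_shiftKernel hx le_rfl 1 m).unique ((((hasSum_signedTerm hx
    (le_refl 2)).mul_left _).add ((hasSum_sub_shift_succ hx hc m).mul_left _)).congr_fun
    fun n => ?_)
  simp only [signedTerm]
  push_cast
  field_simp
  ring

theorem shiftKernel_three_two {x c : ℝ} (hx : x * x = 1) (hc : IsRegularizedValue x c)
    (m : ℕ) : shiftKernel x 3 2 m =
    -(2 / ((m : ℝ) + 1) ^ 3) * signedZeta x 2
      + 3 / ((m : ℝ) + 1) ^ 4 * (c - x ^ (m + 1) * (c - signedSum x 1 (m + 1)))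
      + -(1 / ((m : ℝ) + 1) ^ 3) * (x ^ (m + 1) * (signedZeta x 2 - signedSum x 2 (m + 1))) := by
  refine (hasSum_shiftKernel hx le_rfl 2 m).unique (((((hasSum_signedTerm hx
    (le_refl 2)).mul_left _).add ((hasSum_sub_shift_succ hx hc m).mul_left _)).add
    ((hasSum_shift_succ hx le_rfl m).mul_left _)).congr_fun fun n => ?_)
  simp only [signedTerm]
  push_cast
  field_simp
  ring

theorem shiftKernel_three_three {x c : ℝ} (hx : x * x = 1) (hc : IsRegularizedValue x c)
    (m : ℕ) : shiftKernel x 3 3 m =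
    -(3 / ((m : ℝ) + 1) ^ 4) * signedZeta x 2
      + 6 / ((m : ℝ) + 1) ^ 5 * (c - x ^ (m + 1) * (c - signedSum x 1 (m + 1)))
      + -(3 / ((m : ℝ) + 1) ^ 4) * (x ^ (m + 1) * (signedZeta x 2 - signedSum x 2 (m + 1)))
      + -(1 / ((m : ℝ) + 1) ^ 3) * (x ^ (m + 1) * (signedZeta x 3 - signedSum x 3 (m + 1))) := by
  refine (hasSum_shiftKernel hx le_rfl 3 m).unique ((((((hasSum_signedTerm hx
    (le_refl 2)).mul_left _).add ((hasSum_sub_shift_succ hx hc m).mul_left _)).add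
    ((hasSum_shift_succ hx le_rfl m).mul_left _)).add
    ((hasSum_shift_succ hx (by norm_num : 2 ≤ 3) m).mul_left _)).congr_fun fun n => ?_)
  simp only [signedTerm]
  push_cast
  field_simp
  ring

theorem shiftKernel_four_one {x c : ℝ} (hx : x * x = 1) (hc : IsRegularizedValue x c)
    (m : ℕ) : shiftKernel x 4 1 m =
    -(1 / ((m : ℝ) + 1) ^ 2) * signedZeta x 3 + 1 / ((m : ℝ) + 1) ^ 3 * signedZeta x 2
      + -(1 / ((m : ℝ) + 1) ^ 4) * (c - x ^ (m + 1) * (c - signedSum x 1 (m + 1))) := by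
  refine (hasSum_shiftKernel hx (by norm_num) 1 m).unique (((((hasSum_signedTerm hx
    (by norm_num : 2 ≤ 3)).mul_left _).add ((hasSum_signedTerm hx (le_refl 2)).mul_left _)).add
    ((hasSum_sub_shift_succ hx hc m).mul_left _)).congr_fun fun n => ?_)
  simp only [signedTerm]
  push_cast
  field_simp
  ring

theorem shiftKernel_four_two {x c : ℝ} (hx : x * x = 1) (hc : IsRegularizedValue x c)
    (m : ℕ) : shiftKernel x 4 2 m =
    -(2 / ((m : ℝ) + 1) ^ 3) * signedZeta x 3 + 3 / ((m : ℝ) + 1) ^ 4 * signedZeta x 2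
      + -(4 / ((m : ℝ) + 1) ^ 5) * (c - x ^ (m + 1) * (c - signedSum x 1 (m + 1)))
      + 1 / ((m : ℝ) + 1) ^ 4 * (x ^ (m + 1) * (signedZeta x 2 - signedSum x 2 (m + 1))) := by
  refine (hasSum_shiftKernel hx (by norm_num) 2 m).unique ((((((hasSum_signedTerm hx
    (by norm_num : 2 ≤ 3)).mul_left _).add ((hasSum_signedTerm hx (le_refl 2)).mul_left _)).add
    ((hasSum_sub_shift_succ hx hc m).mul_left _)).add
    ((hasSum_shift_succ hx le_rfl m).mul_left _)).congr_fun fun n => ?_)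
  simp only [signedTerm]
  push_cast
  field_simp
  ring

/-! ### Three parity relations in weight 6 -/

theorem parity_neg_pos_neg {c : ℝ} (hc : Tendsto (signedSum (-1) 1) atTop (𝓝 c)) :
    (signedZeta (-1) 2 * signedZeta 1 2 - signedZeta (-1) 2 * signedZeta (-1) 2) * signedZeta
      (-1) 2 - signedZeta (-1) 2 * doubleSum (-1) 2 (-1) 2 + signedZeta (-1) 2 * doubleSum (-1)
      2 1 2 + (-2 * c * signedZeta 1 2 + 3 * signedZeta (-1) 2 * c) * signedZeta (-1) 3 - 2 *
      signedZeta (-1) 2 * doubleSum (-1) 3 (-1) 1 + c * doubleSum (-1) 3 (-1) 2 - c * doubleSum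
      (-1) 3 1 2 + (-2 * signedZeta 1 2 + 4 * signedZeta (-1) 2 - 3 * c * c) * signedZeta (-1) 4
      + 3 * c * doubleSum (-1) 4 (-1) 1 + doubleSum (-1) 4 (-1) 2 - 10 * c * signedZeta (-1) 5 +
      4 * doubleSum (-1) 5 (-1) 1 - 9 * signedZeta (-1) 6 + (2 * c * signedZeta 1 2 + signedZeta
      (-1) 3) * signedZeta 1 3 - 2 * signedZeta 1 2 * doubleSum 1 3 (-1) 1 + 2 * quadSum 1 3
      (-1) 2 (-1) 1 - 2 * c * doubleSum 1 3 (-1) 2 - doubleSum 1 3 (-1) 3 + (3 * c * c + 3 *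
      signedZeta (-1) 2) * signedZeta 1 4 + 3 * quadSum 1 4 (-1) 1 (-1) 1 - 6 * c * doubleSum 1
      4 (-1) 1 - 3 * doubleSum 1 4 (-1) 2 + 5 * c * signedZeta 1 5 - 5 * doubleSum 1 5 (-1) 1 =
      0 := by
  have hp : (1 : ℝ) * 1 = 1 := one_mul 1
  have hm : (-1 : ℝ) * -1 = 1 := by norm_num
  have Z := fun (s : ℕ) {x : ℝ} (hx : x * x = 1) (hs : 2 ≤ s) (k : ℝ) =>
    (hasSum_signedTerm hx hs).mul_left k
  have D := fun (a b : ℕ) {x y : ℝ} (hx : x * x = 1) (hy : y * y = 1) (ha : 2 ≤ a)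
    (hb : 1 ≤ b) (k : ℝ) => (hasSum_doubleSum hx hy ha hb).mul_left k
  have Q := fun (a b d : ℕ) {x y w : ℝ} (hx : x * x = 1) (hy : y * y = 1) (hw : w * w = 1)
    (ha : 3 ≤ a) (hb : 1 ≤ b) (hd : 1 ≤ d) (k : ℝ) =>
    (hasSum_quadSum hx hy hw ha hb hd).mul_left k
  have h := ((((((((((((((((((((((((Z 2 hm (by decide) (signedZeta (-1) 2 * signedZeta 1 2 -
    signedZeta (-1) 2 * signedZeta (-1) 2)).add (D 2 2 hm hm (by decide) (by decide)
    (-signedZeta (-1) 2))).add (D 2 2 hm hp (by decide) (by decide) (signedZeta (-1) 2))).add (Z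
    3 hm (by decide) (-2 * c * signedZeta 1 2 + 3 * signedZeta (-1) 2 * c))).add (D 3 1 hm hm
    (by decide) (by decide) (-2 * signedZeta (-1) 2))).add (D 3 2 hm hm (by decide) (by decide)
    (c))).add (D 3 2 hm hp (by decide) (by decide) (-c))).add (Z 4 hm (by decide) (-2 *
    signedZeta 1 2 + 4 * signedZeta (-1) 2 - 3 * c * c))).add (D 4 1 hm hm (by decide) (by
    decide) (3 * c))).add (D 4 2 hm hm (by decide) (by decide) (1))).add (Z 5 hm (by decide)
    (-10 * c))).add (D 5 1 hm hm (by decide) (by decide) (4))).add (Z 6 hm (by decide)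
    (-9))).add (Z 3 hp (by decide) (2 * c * signedZeta 1 2 + signedZeta (-1) 3))).add (D 3 1 hp
    hm (by decide) (by decide) (-2 * signedZeta 1 2))).add (Q 3 2 1 hp hm hm (by decide) (by
    decide) (by decide) (2))).add (D 3 2 hp hm (by decide) (by decide) (-2 * c))).add (D 3 3 hp
    hm (by decide) (by decide) (-1))).add (Z 4 hp (by decide) (3 * c * c + 3 * signedZeta (-1)
    2))).add (Q 4 1 1 hp hm hm (by decide) (by decide) (by decide) (3))).add (D 4 1 hp hm (by
    decide) (by decide) (-6 * c))).add (D 4 2 hp hm (by decide) (by decide) (-3))).add (Z 5 hp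
    (by decide) (5 * c))).add (D 5 1 hp hm (by decide) (by decide) (-5)))
  refine Eq.trans ?_ (h.unique ((hasSum_shiftedSum_two_one hm hp hm (le_refl 3) hc).congr_fun
    fun m => ?_))
  · ring
  rw [shiftKernel_three_one hm (isRegularizedValue_of_tendsto hc) m,
    shiftKernel_three_two hm (isRegularizedValue_of_tendsto hc) m,
    shiftKernel_three_three hm (isRegularizedValue_of_tendsto hc) m]
  simp only [signedSum_succ, signedTerm, one_pow, one_mul]
  -- Fixing the value of (-1)^(m+1) makes the termwise identity rational in m and the partial sums.
  rcases neg_one_pow_eq_or ℝ (m + 1) with hu | hu <;> rw [hu] <;> field_simp <;> ring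

theorem parity_pos_neg_neg {c : ℝ} (hc : Tendsto (signedSum (-1) 1) atTop (𝓝 c)) :
    -signedZeta (-1) 2 * signedZeta (-1) 4 + doubleSum (-1) 4 (-1) 2 - c * signedZeta (-1) 5 +
      doubleSum (-1) 5 (-1) 1 + (3 * c * signedZeta 1 2 + signedZeta 1 3) * signedZeta 1 3 +
      quadSum 1 3 (-1) 1 1 2 + (-signedZeta (-1) 2 - 3 * signedZeta 1 2) * doubleSum 1 3 (-1) 1
      + quadSum 1 3 (-1) 2 (-1) 1 - c * doubleSum 1 3 (-1) 2 - c * doubleSum 1 3 1 2 - doubleSum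
      1 3 1 3 + 6 * signedZeta 1 2 * signedZeta 1 4 + 3 * quadSum 1 4 (-1) 1 1 1 - 3 * c *
      doubleSum 1 4 1 1 - 3 * doubleSum 1 4 1 2 - 4 * c * signedZeta 1 5 + 4 * doubleSum 1 5
      (-1) 1 - 6 * doubleSum 1 5 1 1 - 9 * signedZeta 1 6 = 0 := by
  have hp : (1 : ℝ) * 1 = 1 := one_mul 1
  have hm : (-1 : ℝ) * -1 = 1 := by norm_num
  have Z := fun (s : ℕ) {x : ℝ} (hx : x * x = 1) (hs : 2 ≤ s) (k : ℝ) =>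
    (hasSum_signedTerm hx hs).mul_left k
  have D := fun (a b : ℕ) {x y : ℝ} (hx : x * x = 1) (hy : y * y = 1) (ha : 2 ≤ a)
    (hb : 1 ≤ b) (k : ℝ) => (hasSum_doubleSum hx hy ha hb).mul_left k
  have Q := fun (a b d : ℕ) {x y w : ℝ} (hx : x * x = 1) (hy : y * y = 1) (hw : w * w = 1)
    (ha : 3 ≤ a) (hb : 1 ≤ b) (hd : 1 ≤ d) (k : ℝ) =>
    (hasSum_quadSum hx hy hw ha hb hd).mul_left k
  have h := (((((((((((((((((((Z 4 hm (by decide) (-signedZeta (-1) 2)).add (D 4 2 hm hm (by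
    decide) (by decide) (1))).add (Z 5 hm (by decide) (-c))).add (D 5 1 hm hm (by decide) (by
    decide) (1))).add (Z 3 hp (by decide) (3 * c * signedZeta 1 2 + signedZeta 1 3))).add (Q 3 1
    2 hp hm hp (by decide) (by decide) (by decide) (1))).add (D 3 1 hp hm (by decide) (by
    decide) (-signedZeta (-1) 2 - 3 * signedZeta 1 2))).add (Q 3 2 1 hp hm hm (by decide) (by
    decide) (by decide) (1))).add (D 3 2 hp hm (by decide) (by decide) (-c))).add (D 3 2 hp hp
    (by decide) (by decide) (-c))).add (D 3 3 hp hp (by decide) (by decide) (-1))).add (Z 4 hp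
    (by decide) (6 * signedZeta 1 2))).add (Q 4 1 1 hp hm hp (by decide) (by decide) (by decide)
    (3))).add (D 4 1 hp hp (by decide) (by decide) (-3 * c))).add (D 4 2 hp hp (by decide) (by
    decide) (-3))).add (Z 5 hp (by decide) (-4 * c))).add (D 5 1 hp hm (by decide) (by decide)
    (4))).add (D 5 1 hp hp (by decide) (by decide) (-6))).add (Z 6 hp (by decide) (-9)))
  refine Eq.trans ?_ (h.unique ((hasSum_shiftedSum_two_one hp hm hm (le_refl 3) hc).congr_fun
    fun m => ?_))
  · ring
  rw [shiftKernel_three_one hp isRegularizedValue_one m,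
    shiftKernel_three_two hp isRegularizedValue_one m,
    shiftKernel_three_three hp isRegularizedValue_one m]
  simp only [signedSum_succ, signedTerm, one_pow, mul_pow, one_mul]
  rcases neg_one_pow_eq_or ℝ (m + 1) with hu | hu <;> rw [hu] <;> field_simp <;> ring

theorem parity_linear_pos_neg_neg {c : ℝ} (hc : Tendsto (signedSum (-1) 1) atTop (𝓝 c)) :
    -2 * c * signedZeta (-1) 5 + 2 * doubleSum (-1) 5 (-1) 1 + 2 * c * signedZeta 1 3 *
      signedZeta 1 2 - 2 * signedZeta 1 3 * doubleSum 1 2 (-1) 1 + (-2 * c * signedZeta 1 2 + 2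
      * signedZeta 1 3) * signedZeta 1 3 + 2 * signedZeta 1 2 * doubleSum 1 3 (-1) 1 - 4 *
      signedZeta 1 2 * signedZeta 1 4 + quadSum 1 4 (-1) 1 (-1) 1 - 2 * quadSum 1 4 (-1) 1 1 1 -
      2 * c * doubleSum 1 4 (-1) 1 + 2 * c * doubleSum 1 4 1 1 + doubleSum 1 4 1 2 + 2 * c *
      signedZeta 1 5 - 2 * doubleSum 1 5 (-1) 1 + 4 * doubleSum 1 5 1 1 + 6 * signedZeta 1 6 = 0
      := by
  have hp : (1 : ℝ) * 1 = 1 := one_mul 1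
  have hm : (-1 : ℝ) * -1 = 1 := by norm_num
  have Z := fun (s : ℕ) {x : ℝ} (hx : x * x = 1) (hs : 2 ≤ s) (k : ℝ) =>
    (hasSum_signedTerm hx hs).mul_left k
  have D := fun (a b : ℕ) {x y : ℝ} (hx : x * x = 1) (hy : y * y = 1) (ha : 2 ≤ a)
    (hb : 1 ≤ b) (k : ℝ) => (hasSum_doubleSum hx hy ha hb).mul_left k
  have Q := fun (a b d : ℕ) {x y w : ℝ} (hx : x * x = 1) (hy : y * y = 1) (hw : w * w = 1)
    (ha : 3 ≤ a) (hb : 1 ≤ b) (hd : 1 ≤ d) (k : ℝ) =>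
    (hasSum_quadSum hx hy hw ha hb hd).mul_left k
  have h := ((((((((((((((((Z 5 hm (by decide) (-2 * c)).add (D 5 1 hm hm (by decide) (by
    decide) (2))).add (Z 2 hp (by decide) (2 * c * signedZeta 1 3))).add (D 2 1 hp hm (by
    decide) (by decide) (-2 * signedZeta 1 3))).add (Z 3 hp (by decide) (-2 * c * signedZeta 1 2
    + 2 * signedZeta 1 3))).add (D 3 1 hp hm (by decide) (by decide) (2 * signedZeta 1 2))).add
    (Z 4 hp (by decide) (-4 * signedZeta 1 2))).add (Q 4 1 1 hp hm hm (by decide) (by decide)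
    (by decide) (1))).add (Q 4 1 1 hp hm hp (by decide) (by decide) (by decide) (-2))).add (D 4
    1 hp hm (by decide) (by decide) (-2 * c))).add (D 4 1 hp hp (by decide) (by decide) (2 *
    c))).add (D 4 2 hp hp (by decide) (by decide) (1))).add (Z 5 hp (by decide) (2 * c))).add (D
    5 1 hp hm (by decide) (by decide) (-2))).add (D 5 1 hp hp (by decide) (by decide) (4))).add
    (Z 6 hp (by decide) (6)))
  refine Eq.trans ?_ (h.unique ((hasSum_shiftedSum_one_one hp hm hm (by decide : 3 ≤ 4) hc hc).congr_fun
    fun m => ?_))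
  · ring
  rw [shiftKernel_four_one hp isRegularizedValue_one m,
    shiftKernel_four_two hp isRegularizedValue_one m]
  simp only [signedSum_succ, signedTerm, one_pow, mul_pow, one_mul]
  rcases neg_one_pow_eq_or ℝ (m + 1) with hu | hu <;> rw [hu] <;> field_simp <;> ring

/-! ### Shuffle relations and Tornheim values -/

/-- The product is a Tornheim series with `s = 0`. The recurrence lowers the first two exponents
until one vanishes, and what is left is a double sum. -/
theorem shuffle_two_two {x y : ℝ} (hx : x * x = 1) (hy : y * y = 1) :
    signedZeta x 2 * signedZeta y 2 = doubleSum x 2 (x * y) 2 + 2 * doubleSum x 3 (x * y) 1 +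
      doubleSum y 2 (x * y) 2 + 2 * doubleSum y 3 (x * y) 1 := by
  rw [← tornheim_zero_right hx hy (by norm_num) (by norm_num)]
  simp (disch := omega) only [tornheim_succ_succ hx hy, tornheim_zero_middle hx hy,
    tornheim_zero_left hx hy, Nat.reduceAdd, zero_add]
  ring

theorem shuffle_two_three {x y : ℝ} (hx : x * x = 1) (hy : y * y = 1) :
    signedZeta x 2 * signedZeta y 3 = doubleSum x 2 (x * y) 3 + 2 * doubleSum x 3 (x * y) 2 + 3
      * doubleSum x 4 (x * y) 1 + doubleSum y 3 (x * y) 2 + 3 * doubleSum y 4 (x * y) 1 := by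
  rw [← tornheim_zero_right hx hy (by norm_num) (by norm_num)]
  simp (disch := omega) only [tornheim_succ_succ hx hy, tornheim_zero_middle hx hy,
    tornheim_zero_left hx hy, Nat.reduceAdd, zero_add]
  ring

theorem shuffle_two_four {x y : ℝ} (hx : x * x = 1) (hy : y * y = 1) :
    signedZeta x 2 * signedZeta y 4 = doubleSum x 2 (x * y) 4 + 2 * doubleSum x 3 (x * y) 3 + 3
      * doubleSum x 4 (x * y) 2 + 4 * doubleSum x 5 (x * y) 1 + doubleSum y 4 (x * y) 2 + 4 *
      doubleSum y 5 (x * y) 1 := by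
  rw [← tornheim_zero_right hx hy (by norm_num) (by norm_num)]
  simp (disch := omega) only [tornheim_succ_succ hx hy, tornheim_zero_middle hx hy,
    tornheim_zero_left hx hy, Nat.reduceAdd, zero_add]
  ring

theorem shuffle_three_three {x y : ℝ} (hx : x * x = 1) (hy : y * y = 1) :
    signedZeta x 3 * signedZeta y 3 = doubleSum x 3 (x * y) 3 + 3 * doubleSum x 4 (x * y) 2 + 6
      * doubleSum x 5 (x * y) 1 + doubleSum y 3 (x * y) 3 + 3 * doubleSum y 4 (x * y) 2 + 6 *
      doubleSum y 5 (x * y) 1 := by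
  rw [← tornheim_zero_right hx hy (by norm_num) (by norm_num)]
  simp (disch := omega) only [tornheim_succ_succ hx hy, tornheim_zero_middle hx hy,
    tornheim_zero_left hx hy, Nat.reduceAdd, zero_add]
  ring

/-- Evaluation by the recurrence alone; compared with `tornheim_one_one`, it yields a relation
between double sums. The same holds for r = 2, 3, 4 below. -/
theorem tornheim_one_one_one {x y : ℝ} (hx : x * x = 1) (hy : y * y = 1) :
    tornheim x y 1 1 1 = doubleSum x 2 (x * y) 1 + doubleSum y 2 (x * y) 1 := by
  simp (disch := omega) only [tornheim_succ_succ hx hy, tornheim_zero_middle hx hy,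
    tornheim_zero_left hx hy, Nat.reduceAdd, zero_add]

theorem tornheim_one_two_one {x y : ℝ} (hx : x * x = 1) (hy : y * y = 1) :
    tornheim x y 1 2 1 = doubleSum x 2 (x * y) 2 + doubleSum x 3 (x * y) 1 + doubleSum y 3 (x *
      y) 1 := by
  simp (disch := omega) only [tornheim_succ_succ hx hy, tornheim_zero_middle hx hy,
    tornheim_zero_left hx hy, Nat.reduceAdd, zero_add]
  ring

theorem tornheim_one_three_one {x y : ℝ} (hx : x * x = 1) (hy : y * y = 1) :
    tornheim x y 1 3 1 = doubleSum x 2 (x * y) 3 + doubleSum x 3 (x * y) 2 + doubleSum x 4 (x *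
      y) 1 + doubleSum y 4 (x * y) 1 := by
  simp (disch := omega) only [tornheim_succ_succ hx hy, tornheim_zero_middle hx hy,
    tornheim_zero_left hx hy, Nat.reduceAdd, zero_add]
  ring

theorem tornheim_one_four_one {x y : ℝ} (hx : x * x = 1) (hy : y * y = 1) :
    tornheim x y 1 4 1 = doubleSum x 2 (x * y) 4 + doubleSum x 3 (x * y) 3 + doubleSum x 4 (x *
      y) 2 + doubleSum x 5 (x * y) 1 + doubleSum y 5 (x * y) 1 := by
  simp (disch := omega) only [tornheim_succ_succ hx hy, tornheim_zero_middle hx hy,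
    tornheim_zero_left hx hy, Nat.reduceAdd, zero_add]
  ring

/-! ### The constants: log 2 and zeta values -/

theorem signedSum_neg_one_two_mul (N : ℕ) :
    signedSum (-1) 1 (2 * N) = harmonic N - harmonic (2 * N) := by
  induction N with
  | zero => simp [signedSum_zero]
  | succ N ih =>
    rw [show 2 * (N + 1) = 2 * N + 1 + 1 by ring, signedSum_succ, signedSum_succ, ih,
      harmonic_succ, harmonic_succ, harmonic_succ]
    simp only [signedTerm, pow_succ, pow_mul]
    push_cast
    field_simp
    ring

theorem tendsto_signedSum_neg_one_one :
    Tendsto (signedSum (-1) 1) atTop (𝓝 (-Real.log 2)) := by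
  have hanti : Antitone fun i : ℕ => 1 / ((i : ℝ) + 1) := fun i j hij => by
    have : (i : ℝ) ≤ j := by exact_mod_cast hij
    dsimp only
    gcongr
  obtain ⟨l, hl⟩ := hanti.tendsto_alternating_series_of_tendsto_zero
    tendsto_one_div_add_atTop_nhds_zero_nat
  have hl' : Tendsto (signedSum (-1) 1) atTop (𝓝 (-l)) := by
    refine hl.neg.congr fun n => ?_
    rw [signedSum, ← sum_neg_distrib]
    refine sum_congr rfl fun i _ => ?_
    simp only [signedTerm]
    ring
  have h2 : Tendsto (fun N : ℕ => 2 * N) atTop atTop :=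
    tendsto_id.const_mul_atTop' (by norm_num)
  -- H_N - H_{2N}: the Euler–Mascheroni constants cancel and -log 2 remains.
  have hlog : Tendsto (fun N => signedSum (-1) 1 (2 * N)) atTop (𝓝 (-Real.log 2)) := by
    have h := (Real.tendsto_harmonic_sub_log.sub (Real.tendsto_harmonic_sub_log.comp h2)).sub_const
      (Real.log 2)
    rw [sub_self, zero_sub] at h
    refine h.congr' ?_
    filter_upwards [eventually_gt_atTop 0] with N hN
    have hN' : (N : ℝ) ≠ 0 := by positivity
    simp only [Function.comp_apply, signedSum_neg_one_two_mul]
    push_cast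
    rw [Real.log_mul two_ne_zero hN']
    ring
  rwa [tendsto_nhds_unique (hl'.comp h2) hlog] at hl'

/-- Adding the plain and alternating series kills the odd n and doubles the even ones. -/
theorem signedZeta_neg_one {s : ℕ} (hs : 2 ≤ s) :
    signedZeta (-1) s = (2 / 2 ^ s - 1) * signedZeta 1 s := by
  have hp : (1 : ℝ) * 1 = 1 := one_mul 1
  have hm : (-1 : ℝ) * -1 = 1 := by norm_num
  have h := (hasSum_signedTerm hp hs).add (hasSum_signedTerm hm hs)
  have hodd : HasSum (fun i => signedTerm 1 s (2 * i + 1) + signedTerm (-1) s (2 * i + 1))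
      (2 / 2 ^ s * signedZeta 1 s) := by
    refine ((hasSum_signedTerm hp hs).mul_left _).congr_fun fun i => ?_
    simp only [signedTerm, one_pow]
    rw [show 2 * i + 1 + 1 = 2 * (i + 1) by ring, pow_mul, neg_one_sq, one_pow]
    push_cast
    rw [show (2 : ℝ) * i + 1 + 1 = 2 * (i + 1) by ring, mul_pow]
    field_simp
    norm_num
  have heven : HasSum (fun i => signedTerm 1 s (2 * i) + signedTerm (-1) s (2 * i)) 0 := by
    refine hasSum_zero.congr_fun fun i => ?_
    simp [signedTerm, pow_succ, pow_mul]
    ring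
  linarith [h.unique (heven.even_add_odd hodd)]

theorem riemannZeta_eq_signedZeta {s : ℕ} (hs : 2 ≤ s) :
    riemannZeta s = (signedZeta 1 s : ℂ) := by
  rw [zeta_nat_eq_tsum_of_gt_one (by omega), signedZeta, Complex.ofReal_tsum,
    Summable.tsum_eq_zero_add]
  · rw [Nat.cast_zero, zero_pow (by omega), div_zero, zero_add]
    refine tsum_congr fun i => ?_
    simp [signedTerm]
  · have h := Complex.ofRealCLM.summable
      (Real.summable_one_div_nat_pow.mpr (by omega : 1 < s))
    simpa using h

theorem signedZeta_one_two : signedZeta 1 2 = Real.pi ^ 2 / 6 := by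
  have h := riemannZeta_eq_signedZeta (le_refl 2)
  rw [Nat.cast_ofNat, riemannZeta_two] at h
  exact_mod_cast h.symm

theorem signedZeta_one_four : signedZeta 1 4 = Real.pi ^ 4 / 90 := by
  have h := riemannZeta_eq_signedZeta (by norm_num : 2 ≤ 4)
  rw [Nat.cast_ofNat, riemannZeta_four] at h
  exact_mod_cast h.symm

theorem bernoulli'_six : bernoulli' 6 = 1 / 42 := by
  have h5 : bernoulli' 5 = 0 := by
    have h1 : Nat.choose 5 2 = 10 := by decide
    have h2 : Nat.choose 5 3 = 10 := by decide
    rw [bernoulli'_def]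
    norm_num [Finset.sum_range_succ, h1, h2]
  have h1 : Nat.choose 6 2 = 15 := by decide
  have h2 : Nat.choose 6 4 = 15 := by decide
  rw [bernoulli'_def]
  norm_num [Finset.sum_range_succ, h1, h2, h5]

theorem signedZeta_one_six : signedZeta 1 6 = Real.pi ^ 6 / 945 := by
  have h := riemannZeta_eq_signedZeta (by norm_num : 2 ≤ 6)
  have h6 := riemannZeta_two_mul_nat (show (3 : ℕ) ≠ 0 by norm_num)
  rw [show 2 * 3 = 6 from rfl, bernoulli_eq_bernoulli'_of_ne_one (by norm_num),
    bernoulli'_six, show (2 : ℂ) * (3 : ℕ) = (6 : ℕ) by norm_num, h] at h6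
  have hf : Nat.factorial 6 = 720 := rfl
  rw [hf] at h6
  have : (signedZeta 1 6 : ℂ) = ((Real.pi ^ 6 / 945 : ℝ) : ℂ) := by
    rw [h6]
    push_cast
    ring
  exact_mod_cast this

/-! ### Translation of the stated sums into strict sums -/

theorem sum_Icc_one_eq_sum_range (f : ℕ → ℝ) (N : ℕ) :
    ∑ n ∈ Icc 1 N, f n = ∑ i ∈ range N, f (i + 1) := by
  induction N with
  | zero => simp
  | succ N ih => rw [sum_Icc_succ_top (by omega), ih, sum_range_succ]

theorem Index.factor_plain_succ (s n : ℕ) : (Index.plain s).factor (n + 1) = signedTerm 1 s n := by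
  simp [Index.factor, signedTerm]

theorem Index.factor_bar_succ (s n : ℕ) : (Index.bar s).factor (n + 1) = signedTerm (-1) s n := by
  simp [Index.factor, signedTerm]

theorem hasSum_zetaStarTerm {a b : Index} {x y : ℝ} {s t : ℕ} (hx : x * x = 1) (hy : y * y = 1)
    (hs : 2 ≤ s) (ht : 1 ≤ t) (ha : ∀ n, a.factor (n + 1) = signedTerm x s n)
    (hb : ∀ n, b.factor (n + 1) = signedTerm y t n) :
    HasSum (fun m => zetaStarTerm a b (m + 1))
      (doubleSum x s y t + signedZeta (x * y) (s + t)) := by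
  refine ((hasSum_doubleSum hx hy hs ht).add (hasSum_signedTerm (mul_mul_self_eq_one hx hy)
    (by omega : 2 ≤ s + t))).congr_fun fun m => ?_
  rw [zetaStarTerm, ha, sum_Icc_one_eq_sum_range, sum_congr rfl fun n _ => hb n,
    ← signedSum, signedSum_succ]
  simp only [signedTerm, mul_pow, pow_add]
  field_simp

theorem altPartial_one_eq (n : ℕ) : altPartial n 1 = -signedSum (-1) 1 n := by
  rw [altPartial, sum_Icc_one_eq_sum_range, signedSum, ← sum_neg_distrib]
  refine sum_congr rfl fun i _ => ?_
  simp only [signedTerm, add_tsub_cancel_right, pow_succ]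
  push_cast
  ring

theorem zetaPartial_eq (n k : ℕ) : zetaPartial n k = signedSum 1 k n := by
  rw [zetaPartial, sum_Icc_one_eq_sum_range, signedSum]
  simp [signedTerm]

theorem hasSum_altPartial_mul_zetaPartial :
    HasSum (fun n : ℕ => altPartial (n + 1) 1 * zetaPartial (n + 1) 2 / ((n + 1 : ℕ) : ℝ) ^ 3)
      (-(quadSum 1 3 (-1) 1 1 2 + doubleSum 1 5 (-1) 1 + doubleSum (-1) 4 1 2
        + signedZeta (-1) 6)) := by
  have hp : (1 : ℝ) * 1 = 1 := one_mul 1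
  have hm : (-1 : ℝ) * -1 = 1 := by norm_num
  refine ((((hasSum_quadSum hp hm hp le_rfl le_rfl one_le_two).add
    (hasSum_doubleSum hp hm (by norm_num) le_rfl)).add
    (hasSum_doubleSum hm hp (by norm_num) one_le_two)).add
    (hasSum_signedTerm hm (by norm_num))).neg.congr_fun fun n => ?_
  rw [altPartial_one_eq, zetaPartial_eq, signedSum_succ, signedSum_succ]
  simp only [signedTerm, one_pow]
  push_cast
  field_simp
  ring

/-! ### Elimination and conclusion -/

theorem quadratic_eulerSum_evaluation :
    -(quadSum 1 3 (-1) 1 1 2 + doubleSum 1 5 (-1) 1 + doubleSum (-1) 4 1 2 + signedZeta (-1) 6)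
      = 29 / 8 * signedZeta 1 2 * signedZeta 1 3 * Real.log 2
        - 93 / 32 * signedZeta 1 5 * Real.log 2 - 1855 / 128 * signedZeta 1 6
        + 17 / 16 * signedZeta 1 3 ^ 2
        - (doubleSum (-1) 5 (-1) 1 + signedZeta 1 6) - (doubleSum 1 4 (-1) 2 + signedZeta (-1) 6)
        - 4 * (doubleSum (-1) 4 1 2 + signedZeta (-1) 6)
        - 8 * (doubleSum (-1) 5 1 1 + signedZeta (-1) 6) := by
  have hp : (1 : ℝ) * 1 = 1 := one_mul 1
  have hm : (-1 : ℝ) * -1 = 1 := by norm_num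
  have hc := tendsto_signedSum_neg_one_one
  have hr := isRegularizedValue_of_tendsto hc
  have p₁ := parity_neg_pos_neg hc
  have p₂ := parity_pos_neg_neg hc
  have p₃ := parity_linear_pos_neg_neg hc
  have sh₂₄pm := shuffle_two_four hp hm
  have sh₂₄pp := shuffle_two_four hp hp
  have sh₃₃pm := shuffle_three_three hp hm
  have sh₃₃pp := shuffle_three_three hp hp
  have sh₂₂mm := shuffle_two_two hm hm
  have sh₂₂pm := shuffle_two_two hp hm
  have sh₂₃mm := shuffle_two_three hm hm
  have sh₂₃pm := shuffle_two_three hp hm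
  have sh₂₃pp := shuffle_two_three hp hp
  have t₄mp := (tornheim_one_four_one hm hp).symm.trans (tornheim_one_one hm hp hr (by norm_num))
  have t₄pm := (tornheim_one_four_one hp hm).symm.trans
    (tornheim_one_one hp hm isRegularizedValue_one (by norm_num))
  have t₁mp := (tornheim_one_one_one hm hp).symm.trans (tornheim_one_one hm hp hr (by norm_num))
  have t₂mm := (tornheim_one_two_one hm hm).symm.trans (tornheim_one_one hm hm hr (by norm_num))
  have t₃mm := (tornheim_one_three_one hm hm).symm.trans
    (tornheim_one_one hm hm hr (by norm_num))
  have t₃pp := (tornheim_one_three_one hp hp).symm.trans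
    (tornheim_one_one hp hp isRegularizedValue_one (by norm_num))
  have st₂₄mm := doubleSum_add_doubleSum hm hm (by decide : 2 ≤ 2) (by decide : 2 ≤ 4)
  have st₃₃mm := doubleSum_add_doubleSum hm hm (by decide : 2 ≤ 3) (by decide : 2 ≤ 3)
  have st₂₄pm := doubleSum_add_doubleSum hp hm (by decide : 2 ≤ 2) (by decide : 2 ≤ 4)
  have st₂₄pp := doubleSum_add_doubleSum hp hp (by decide : 2 ≤ 2) (by decide : 2 ≤ 4)
  have st₃₃pp := doubleSum_add_doubleSum hp hp (by decide : 2 ≤ 3) (by decide : 2 ≤ 3)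
  have st₂₃mp := doubleSum_add_doubleSum hm hp (by decide : 2 ≤ 2) (by decide : 2 ≤ 3)
  have st₂₂pm := doubleSum_add_doubleSum hp hm (by decide : 2 ≤ 2) (by decide : 2 ≤ 2)
  have st₂₃pm := doubleSum_add_doubleSum hp hm (by decide : 2 ≤ 2) (by decide : 2 ≤ 3)
  have st₂₃pp := doubleSum_add_doubleSum hp hp (by decide : 2 ≤ 2) (by decide : 2 ≤ 3)
  have e₂ := signedZeta_neg_one (by norm_num : 2 ≤ 2)
  have e₃ := signedZeta_neg_one (by norm_num : 2 ≤ 3)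
  have e₄ := signedZeta_neg_one (by norm_num : 2 ≤ 4)
  have e₅ := signedZeta_neg_one (by norm_num : 2 ≤ 5)
  have e₆ := signedZeta_neg_one (by norm_num : 2 ≤ 6)
  -- Even zeta values become powers of π, so that products such as ζ(2)ζ(4) and ζ(6) can be
  -- compared.
  simp only [one_mul, mul_one, hm, Nat.reduceAdd, zero_mul, sub_zero, zero_add, e₂, e₃, e₄, e₅, e₆,
    signedZeta_one_two, signedZeta_one_four, signedZeta_one_six] at *
  -- The weights 1/2, -1, -3/2 of the parity relations cancel the other three quadratic sums and
  -- leave the target with coefficient -1. The remaining coefficients eliminate the unwanted double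
  -- sums; relations of weight 4, 3 and 5 enter multiplied by ζ(2), ζ(3) and log 2.
  linear_combination 1 / 2 * p₁ - p₂ - 3 / 2 * p₃ - 5 * sh₂₄pm - 3 / 2 * sh₂₄pp + 3 / 2 * sh₃₃pm
    + sh₃₃pp - 1 / 2 * t₄mp - 8 * t₄pm + 1 / 2 * st₂₄mm + st₃₃mm + 3 * st₂₄pm - 3 / 2 * st₂₄pp
    - st₃₃pp + Real.pi ^ 2 / 6 * (-sh₂₂mm + 1 / 4 * sh₂₂pm - 2 * t₂mm + 1 / 4 * st₂₂pm)
    - 3 * signedZeta 1 3 * t₁mp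
    + Real.log 2 * (1 / 2 * sh₂₃mm - 1 / 2 * sh₂₃pm - 1 / 2 * sh₂₃pp + 3 / 2 * t₃mm - 3 * t₃pp
      - st₂₃mp - 1 / 2 * st₂₃pm + 5 / 2 * st₂₃pp)

end EulerSum

theorem mainTheorem12 :
    Summable (fun m : ℕ => EulerSum.zetaStarTerm (.bar 5) (.bar 1) (m + 1)) ∧
    Summable (fun m : ℕ => EulerSum.zetaStarTerm (.plain 4) (.bar 2) (m + 1)) ∧
    Summable (fun m : ℕ => EulerSum.zetaStarTerm (.bar 4) (.plain 2) (m + 1)) ∧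
    Summable (fun m : ℕ => EulerSum.zetaStarTerm (.bar 5) (.plain 1) (m + 1)) ∧
    HasSum
      (fun n : ℕ =>
        ((EulerSum.altPartial (n + 1) 1 * EulerSum.zetaPartial (n + 1) 2
          / ((n + 1 : ℕ) : ℝ) ^ 3 : ℝ) : ℂ))
      (29 / 8 * riemannZeta 2 * riemannZeta 3 * (Real.log 2 : ℂ)
        - 93 / 32 * riemannZeta 5 * (Real.log 2 : ℂ)
        - 1855 / 128 * riemannZeta 6
        + 17 / 16 * riemannZeta 3 ^ 2
        - (EulerSum.zetaStar (.bar 5) (.bar 1) : ℂ)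
        - (EulerSum.zetaStar (.plain 4) (.bar 2) : ℂ)
        - 4 * (EulerSum.zetaStar (.bar 4) (.plain 2) : ℂ)
        - 8 * (EulerSum.zetaStar (.bar 5) (.plain 1) : ℂ)) := by
  have hp : (1 : ℝ) * 1 = 1 := one_mul 1
  have hm : (-1 : ℝ) * -1 = 1 := by norm_num
  have h₁ := EulerSum.hasSum_zetaStarTerm hm hm (by norm_num : 2 ≤ 5) le_rfl
    (EulerSum.Index.factor_bar_succ 5) (EulerSum.Index.factor_bar_succ 1)
  have h₂ := EulerSum.hasSum_zetaStarTerm hp hm (by norm_num : 2 ≤ 4) one_le_two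
    (EulerSum.Index.factor_plain_succ 4) (EulerSum.Index.factor_bar_succ 2)
  have h₃ := EulerSum.hasSum_zetaStarTerm hm hp (by norm_num : 2 ≤ 4) one_le_two
    (EulerSum.Index.factor_bar_succ 4) (EulerSum.Index.factor_plain_succ 2)
  have h₄ := EulerSum.hasSum_zetaStarTerm hm hp (by norm_num : 2 ≤ 5) le_rfl
    (EulerSum.Index.factor_bar_succ 5) (EulerSum.Index.factor_plain_succ 1)
  refine ⟨h₁.summable, h₂.summable, h₃.summable, h₄.summable, ?_⟩
  have h := EulerSum.hasSum_altPartial_mul_zetaPartial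
  rw [EulerSum.quadratic_eulerSum_evaluation] at h
  rw [hm] at h₁
  rw [one_mul] at h₂
  rw [mul_one] at h₃ h₄
  have z₂ := EulerSum.riemannZeta_eq_signedZeta (le_refl 2)
  have z₃ := EulerSum.riemannZeta_eq_signedZeta (by norm_num : 2 ≤ 3)
  have z₅ := EulerSum.riemannZeta_eq_signedZeta (by norm_num : 2 ≤ 5)
  have z₆ := EulerSum.riemannZeta_eq_signedZeta (by norm_num : 2 ≤ 6)
  rw [Nat.cast_ofNat] at z₂ z₃ z₅ z₆
  simp only [EulerSum.zetaStar, h₁.tsum_eq, h₂.tsum_eq, h₃.tsum_eq, h₄.tsum_eq, z₂, z₃, z₅, z₆]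
  convert Complex.hasSum_ofReal.mpr h using 1
  push_cast
  ring
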